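/- For $\sigma \in \mathbb{R}$ let $N_3(\sigma) = \#\{v \in \mathbb{Z}^3 : |v| \le \sigma\}$, where $|\cdot|$ is the Euclidean norm, and for $\Sigma \ge 0$ let $N_{3,1}(\Sigma) = \int_0^\Sigma N_3(\sigma)\,d\sigma$. Then, as $\Sigma \to \infty$, $$N_{3,1}(\Sigma) = \frac{\pi}{3}\Sigma^4 + O(\Sigma \log \Sigma).$$ Moreover, there do not exist $\varepsilon > 0$ and $\alpha \in \mathbb{R}$ such that, as $\Sigma \to \infty$, $$N_{3,1}(\Sigma) = \frac{\pi}{3}\Sigma^4 + \alpha \Sigma + O(\Sigma^{1-\varepsilon}).$$ -/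

import Mathlib

open scoped Asymptotics

/-- The set of integer points `v ∈ ℤ^d` of Euclidean norm `|v| ≤ R`. -/
def latticeBall (d : ℕ) (R : ℝ) : Set (Fin d → ℤ) :=
  {v | ‖(WithLp.toLp 2 (fun i => (v i : ℝ)) : EuclideanSpace ℝ (Fin d))‖ ≤ R}

/-- The lattice point counting function `N_d(R) = #{v ∈ ℤ^d : |v| ≤ R}`
(it vanishes for `R < 0`). -/
noncomputable def latticeCount (d : ℕ) (R : ℝ) : ℕ :=
  (latticeBall d R).ncard

/-- The iterated integrals of `N_3`: `N_{3,0} = N_3` and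
`N_{3,k+1}(R) = ∫_0^R N_{3,k}(r) dr`. -/
noncomputable def iterCount : ℕ → ℝ → ℝ
  | 0, R => (latticeCount 3 R : ℝ)
  | k + 1, R => ∫ r in (0 : ℝ)..R, iterCount k r

/-- The set counted by `latticeCount` is finite. -/
theorem latticeBall_finite (d : ℕ) (R : ℝ) : (latticeBall d R).Finite := by
  refine (Set.Finite.pi' (t := fun _ : Fin d => Set.Icc (-⌊R⌋) ⌊R⌋)
    (fun _ => Set.finite_Icc _ _)).subset ?_
  intro v hv i
  have h1 : ‖((v i : ℤ) : ℝ)‖ ≤ R :=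
    (PiLp.norm_apply_le
      (WithLp.toLp 2 (fun i => (v i : ℝ)) : EuclideanSpace ℝ (Fin d)) i).trans hv
  rw [Real.norm_eq_abs, abs_le] at h1
  refine ⟨?_, Int.le_floor.2 h1.2⟩
  have h2 : -(v i) ≤ ⌊R⌋ := Int.le_floor.2 (by push_cast; linarith [h1.1])
  linarith

/-- The counting function is nondecreasing. -/
theorem latticeCount_mono (d : ℕ) : Monotone (latticeCount d) := fun _ b h =>
  Set.ncard_le_ncard (fun _ hv => le_trans hv h) (latticeBall_finite d b)

/-- The integral that defines `N_{3,1}` is an integral of an integrable function. -/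
theorem iterCount_zero_intervalIntegrable (a b : ℝ) :
    IntervalIntegrable (iterCount 0) MeasureTheory.volume a b := by
  have h : Monotone (iterCount 0) := fun x y hxy => by
    simpa [iterCount] using latticeCount_mono 3 hxy
  exact h.intervalIntegrable

/-!
The proof rests on an exact formula for the second iterated integral `N₂ = iterCount 2`. Writing
`k = 2π|ξ|`, for `x > 0`

  `N₂(x) = (π/15) x⁵ + 4π ∑_{ξ ≠ 0} (x (2 + cos kx) / k⁴ - 3 sin kx / k⁵)`,

the sum over `ξ ∈ ℤ³` being absolutely convergent (`iterCount_two_eq_expansion`). This is Poisson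
summation in `ℝ³`, reached without Fourier analysis on `ℝ³`. The cube of the functional equation of
the theta function gives `∑ exp (-|v|²/u)` in terms of `∑ exp (-π²|ξ|²u)`. The exponential
`exp (-s|v|)` is a mixture of the Gaussians `exp (-|v|²/u)` (`subordinator_integral`), so that
`∑ exp (-s|v|) = ∑ 8πs / (s² + k²)²` for `s > 0` (`tsum_exp_neg_mul_latticeNorm`). After division by
`s³` the two sides are the Laplace transforms of the two sides of the formula, and the Laplace
transform is injective on continuous functions (`eqOn_zero_of_laplace_eq_zero`, by Weierstrass
approximation in the variable `exp (-x)`).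

For the upper bound, `N₁ = iterCount 1` is monotone and so lies between its means over the two
intervals of length `η = x⁻²` adjacent to `x`, which are difference quotients of `N₂`. The
difference of the `ξ`-th term is `O(x min (η / k³, 1 / k⁴)) = O(x η^(1-θ) k^(-3-θ))`, and
`∑ |ξ|^(-3-θ) = O(1/θ)`; with `θ = 1 / log x` the total is `O(η x log x)`.

For the second claim, suppose `N₁(x) = (π/3) x⁴ + αx + o(x)`. Integration over `[x, x + 1/2]` shows
that `A(x + 1/2) - A(x)` has a limit as `x → ∞`, where `A(x) = ∑ (2 + cos kx) / k⁴`. Hence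
`A(n + 1/2) - 2 A(n) + A(n - 1/2) = ∑ 2 (cos (k/2) - 1) cos (kn) / k⁴` tends to `0` along the
integers. By recurrence in the compact group of families of points of the circle, its value at
`n = 0` is a cluster point, hence `0`; but that value is a sum of terms `≤ 0`, not all zero.
-/

open MeasureTheory Set Filter Topology Real

/-! ### Uniqueness for the Laplace transform -/

/-- A continuous function that is `o(exp x)` and whose Laplace transform vanishes at the integers
`≥ 2` vanishes on the positive half line: `w = f exp (-·)` is a uniform limit of polynomials in
`exp (-x)`, and is orthogonal to all of these with respect to `exp (-x) dx`. -/
theorem eqOn_zero_of_laplace_eq_zero {f : ℝ → ℝ} (hf : Continuous f)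
    (hlim : Tendsto (fun x => f x * exp (-x)) atTop (𝓝 0))
    (hzero : ∀ n : ℕ, ∫ x in Ioi (0 : ℝ), f x * exp (-((n + 2 : ℕ) : ℝ) * x) = 0) :
    ∀ x, 0 < x → f x = 0 := by
  have hexp : IntegrableOn (fun x : ℝ => exp (-x)) (Ioi 0) := integrableOn_exp_neg_Ioi 0
  set w : ℝ → ℝ := fun x => f x * exp (-x) with hw
  have hwc : Continuous w := by fun_prop
  -- in the variable `y = exp (-x)` the function `w` extends continuously to `[0, 1]`
  set g : ℝ → ℝ := fun y => if y = 0 then 0 else w (-log y) with hg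
  have hgc : ContinuousOn g (Icc 0 1) := by
    intro y hy
    rcases hy.1.eq_or_lt with rfl | hy0
    · have h1 : Tendsto (fun y => w (-log y)) (𝓝[>] 0) (𝓝 0) :=
        hlim.comp (tendsto_neg_atBot_atTop.comp tendsto_log_nhdsGT_zero)
      have h2 : ContinuousWithinAt g (Ioi 0) 0 := by
        have : g 0 = 0 := by simp [hg]
        rw [ContinuousWithinAt, this]
        refine h1.congr' ?_
        filter_upwards [self_mem_nhdsWithin] with y hy
        simp [hg, (mem_Ioi.1 hy).ne']
      exact (continuousWithinAt_Ioi_iff_Ici.1 h2).mono (fun z hz => hz.1)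
    · have h1 : ContinuousAt (fun y => w (-log y)) y :=
        hwc.continuousAt.comp (continuousAt_log hy0.ne').neg
      refine (h1.congr ?_).continuousWithinAt
      filter_upwards [lt_mem_nhds hy0] with z hz
      simp [hg, hz.ne']
  have hgw : ∀ x, g (exp (-x)) = w x := fun x => by simp [hg, (exp_pos _).ne']
  obtain ⟨M, hM⟩ := isCompact_Icc.exists_bound_of_continuousOn hgc
  have hmem : ∀ x ∈ Ioi (0 : ℝ), exp (-x) ∈ Icc (0 : ℝ) 1 := fun x hx =>
    ⟨(exp_pos _).le, exp_le_one_iff.2 (by linarith [mem_Ioi.1 hx])⟩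
  have hwM : ∀ x ∈ Ioi (0 : ℝ), |w x| ≤ M := fun x hx => by
    rw [← hgw]; exact hM _ (hmem x hx)
  -- products of `exp (-x)` with continuous functions bounded on the half line are integrable
  have hint : ∀ (u : ℝ → ℝ) (B : ℝ), Continuous u → (∀ x ∈ Ioi (0 : ℝ), |u x| ≤ B) →
      IntegrableOn (fun x => u x * exp (-x)) (Ioi 0) := by
    intro u B hu hB
    refine Integrable.bdd_mul (c := B) hexp hu.aestronglyMeasurable ?_
    filter_upwards [ae_restrict_mem measurableSet_Ioi] with x hx using hB x hx
  have hpow : ∀ n : ℕ, IntegrableOn (fun x => w x * exp (-x) ^ n * exp (-x)) (Ioi 0) := by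
    intro n
    refine hint (fun x => w x * exp (-x) ^ n) M (by fun_prop) fun x hx => ?_
    rw [abs_mul, abs_of_nonneg (by positivity : 0 ≤ exp (-x) ^ n)]
    have h1 := pow_le_one₀ (hmem x hx).1 (hmem x hx).2 (n := n)
    nlinarith [hwM x hx, abs_nonneg (w x)]
  have hpoly : ∀ p : Polynomial ℝ,
      IntegrableOn (fun x => w x * p.eval (exp (-x)) * exp (-x)) (Ioi 0) ∧
      ∫ x in Ioi (0 : ℝ), w x * p.eval (exp (-x)) * exp (-x) = 0 := by
    intro p
    have h1 : (fun x => w x * p.eval (exp (-x)) * exp (-x)) = fun x =>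
        ∑ i ∈ Finset.range (p.natDegree + 1), p.coeff i * (w x * exp (-x) ^ i * exp (-x)) := by
      funext x
      rw [Polynomial.eval_eq_sum_range, Finset.mul_sum, Finset.sum_mul]
      exact Finset.sum_congr rfl fun i _ => by ring
    rw [h1]
    refine ⟨integrable_finsetSum _ fun i _ => (hpow i).const_mul _, ?_⟩
    rw [integral_finsetSum _ fun i _ => (hpow i).const_mul _]
    refine Finset.sum_eq_zero fun i _ => ?_
    rw [integral_const_mul]
    have h2 : (fun x => w x * exp (-x) ^ i * exp (-x)) =
        fun x => f x * exp (-((i + 2 : ℕ) : ℝ) * x) := by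
      funext x
      simp only [hw]
      rw [← exp_nat_mul, mul_assoc, mul_assoc, ← exp_add, ← exp_add]
      push_cast
      ring_nf
    rw [h2, hzero, mul_zero]
  have hsqint : IntegrableOn (fun x => w x * w x * exp (-x)) (Ioi 0) := by
    refine hint (fun x => w x * w x) (M * M) (by fun_prop) fun x hx => ?_
    rw [abs_mul]
    exact mul_le_mul (hwM x hx) (hwM x hx) (abs_nonneg _) ((abs_nonneg _).trans (hwM x hx))
  have hM0 : 0 ≤ M := (abs_nonneg _).trans (hwM 1 (by simp))
  have hsq : ∫ x in Ioi (0 : ℝ), w x * w x * exp (-x) ≤ 0 := by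
    refine le_of_forall_pos_le_add fun ε hε => ?_
    obtain ⟨p, hp⟩ := exists_polynomial_near_of_continuousOn 0 1 g hgc (ε / (M + 1)) (by positivity)
    have h1 : ∫ x in Ioi (0 : ℝ), w x * w x * exp (-x) =
        ∫ x in Ioi (0 : ℝ), (w x * w x * exp (-x) - w x * p.eval (exp (-x)) * exp (-x)) := by
      rw [integral_sub hsqint (hpoly p).1, (hpoly p).2, sub_zero]
    rw [h1, zero_add]
    calc _ ≤ ∫ x in Ioi (0 : ℝ), ε * exp (-x) := by
          refine setIntegral_mono_on (hsqint.sub (hpoly p).1) (hexp.const_mul _)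
            measurableSet_Ioi fun x hx => ?_
          have h2 := hp _ (hmem x hx)
          rw [hgw] at h2
          have h3 : w x * w x - w x * p.eval (exp (-x)) ≤ ε := by
            calc _ ≤ |w x * (p.eval (exp (-x)) - w x)| := by
                  rw [← abs_neg]; refine le_trans (le_of_eq ?_) (le_abs_self _); ring
              _ ≤ (M + 1) * (ε / (M + 1)) := by
                  rw [abs_mul]
                  exact mul_le_mul ((hwM x hx).trans (by linarith)) h2.le (abs_nonneg _)
                    (by linarith)
              _ = ε := by field_simp
          nlinarith [exp_pos (-x)]
      _ = ε := by rw [integral_const_mul, integral_exp_neg_Ioi_zero, mul_one]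
  have hnn : 0 ≤ fun x => w x * w x * exp (-x) := fun x =>
    mul_nonneg (mul_self_nonneg _) (exp_pos _).le
  have hae := (setIntegral_eq_zero_iff_of_nonneg_ae (ae_of_all _ hnn) hsqint).1
    (le_antisymm hsq (setIntegral_nonneg measurableSet_Ioi fun x _ => hnn x))
  have heq := Measure.eqOn_open_of_ae_eq (f := fun x => w x * w x * exp (-x)) (g := fun _ => 0) hae
    isOpen_Ioi (by fun_prop) (by fun_prop)
  intro x hx
  have := heq hx
  simpa [hw, (exp_pos _).ne'] using this

/-! ### The subordination identity -/

/-- The error function without its usual normalisation. -/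
noncomputable def gaussPrimitive (y : ℝ) : ℝ := ∫ t in (0 : ℝ)..y, exp (-t ^ 2)

theorem hasDerivAt_gaussPrimitive (y : ℝ) : HasDerivAt gaussPrimitive (exp (-y ^ 2)) y :=
  (by fun_prop : Continuous fun t : ℝ => exp (-t ^ 2)).integral_hasStrictDerivAt 0 y |>.hasDerivAt

theorem continuous_gaussPrimitive : Continuous gaussPrimitive :=
  continuous_iff_continuousAt.2 fun y => (hasDerivAt_gaussPrimitive y).continuousAt

theorem gaussPrimitive_neg (y : ℝ) : gaussPrimitive (-y) = -gaussPrimitive y := by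
  have := intervalIntegral.integral_comp_neg (a := 0) (b := y) (fun t : ℝ => exp (-t ^ 2))
  simp only [neg_zero, even_two, Even.neg_pow] at this
  rw [gaussPrimitive, gaussPrimitive, this, intervalIntegral.integral_symm]

theorem tendsto_gaussPrimitive_atTop : Tendsto gaussPrimitive atTop (𝓝 (√π / 2)) := by
  have h := integral_gaussian_Ioi 1
  simp only [neg_mul, one_mul, div_one] at h
  rw [← h]
  refine intervalIntegral_tendsto_integral_Ioi 0 ?_ tendsto_id
  have := (integrable_exp_neg_mul_sq (b := 1) one_pos).integrableOn (s := Ioi 0)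
  simpa using this

theorem tendsto_gaussPrimitive_atBot : Tendsto gaussPrimitive atBot (𝓝 (-(√π / 2))) := by
  have h := (tendsto_gaussPrimitive_atTop.comp tendsto_neg_atBot_atTop).neg
  refine h.congr fun y => ?_
  simp [gaussPrimitive_neg]

/-- The heat kernel in the variable `u = 1/t`, normalised so that its integral over `u > 0` is the
exponential `exp (-s r)`. -/
noncomputable def subordinator (s r u : ℝ) : ℝ :=
  s / (2 * √π) * ((√u)⁻¹ * exp (-(s ^ 2 / 4 * u + r ^ 2 / u)))

theorem subordinator_nonneg {s : ℝ} (hs : 0 < s) (r u : ℝ) : 0 ≤ subordinator s r u := by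
  unfold subordinator; positivity

/-- The integrand has an explicit primitive, a combination of values of the error function at
`s√u / 2 ± r / √u`. -/
theorem subordinator_integral {s r : ℝ} (hs : 0 < s) (hr : 0 ≤ r) :
    IntegrableOn (subordinator s r) (Ioi 0) ∧
      ∫ u in Ioi (0 : ℝ), subordinator s r u = exp (-(s * r)) := by
  have hπ : 0 < √π := sqrt_pos.2 pi_pos
  set F : ℝ → ℝ := fun u => (√π)⁻¹ * (exp (s * r) * gaussPrimitive (s / 2 * √u + r / √u) +
    exp (-(s * r)) * gaussPrimitive (s / 2 * √u - r / √u)) with hF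
  set l : ℝ := 2⁻¹ * (exp (s * r) - exp (-(s * r))) with hl
  -- the value at the left end point is the limit there, which the junk value `r / √0` misses
  set G : ℝ → ℝ := fun u => if u = 0 then l else F u with hG
  have h0 : Tendsto (fun u : ℝ => √u) (𝓝[>] 0) (𝓝 0) := by
    have : Tendsto (fun u : ℝ => √u) (𝓝 0) (𝓝 0) := by
      simpa using continuous_sqrt.tendsto 0
    exact this.mono_left nhdsWithin_le_nhds
  have h0' : Tendsto (fun u : ℝ => √u) (𝓝[>] 0) (𝓝[>] 0) :=
    tendsto_nhdsWithin_iff.2 ⟨h0, by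
      filter_upwards [self_mem_nhdsWithin] with u hu using sqrt_pos.2 hu⟩
  have hF0 : Tendsto F (𝓝[>] 0) (𝓝 l) := by
    have h1 : Tendsto (fun u : ℝ => s / 2 * √u) (𝓝[>] 0) (𝓝 0) := by
      simpa using h0.const_mul (s / 2)
    rcases hr.eq_or_lt with rfl | hr
    · have h2 := (continuous_gaussPrimitive.tendsto 0).comp h1
      have h3 := (h2.add h2).const_mul (√π)⁻¹
      have h4 : gaussPrimitive 0 = 0 := intervalIntegral.integral_same
      simpa [hF, hl, h4, Function.comp_def] using h3
    · have h2 : Tendsto (fun u : ℝ => r / √u) (𝓝[>] 0) atTop := by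
        simpa [div_eq_mul_inv] using (tendsto_inv_nhdsGT_zero.comp h0').const_mul_atTop hr
      have h3 := tendsto_gaussPrimitive_atTop.comp (h1.add_atTop h2)
      have h4 := tendsto_gaussPrimitive_atBot.comp
        (h1.add_atBot (tendsto_neg_atTop_atBot.comp h2))
      have h5 := ((h3.const_mul (exp (s * r))).add (h4.const_mul (exp (-(s * r))))).const_mul (√π)⁻¹
      have e : l = (√π)⁻¹ * (exp (s * r) * (√π / 2) + exp (-(s * r)) * -(√π / 2)) := by
        rw [hl]; field_simp; ring
      rw [e]
      refine h5.congr fun u => ?_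
      simp [hF, sub_eq_add_neg]
  have hFtop : Tendsto F atTop (𝓝 (l + exp (-(s * r)))) := by
    have h1 : Tendsto (fun u : ℝ => s / 2 * √u) atTop atTop :=
      tendsto_sqrt_atTop.const_mul_atTop (by positivity)
    have h2 : Tendsto (fun u : ℝ => r / √u) atTop (𝓝 0) := tendsto_sqrt_atTop.const_div_atTop r
    have h3 := tendsto_gaussPrimitive_atTop.comp (h1.atTop_add h2)
    have h4 := tendsto_gaussPrimitive_atTop.comp (h1.atTop_add h2.neg)
    have h5 := ((h3.const_mul (exp (s * r))).add (h4.const_mul (exp (-(s * r))))).const_mul (√π)⁻¹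
    have e : l + exp (-(s * r)) =
        (√π)⁻¹ * (exp (s * r) * (√π / 2) + exp (-(s * r)) * (√π / 2)) := by
      rw [hl]; field_simp; ring
    rw [e]
    refine h5.congr fun u => ?_
    simp [hF, sub_eq_add_neg]
  have hGF : ∀ u, u ≠ 0 → G =ᶠ[𝓝 u] F := by
    intro u hu
    filter_upwards [isOpen_ne.mem_nhds hu] with z hz
    exact if_neg hz
  have hcont : ContinuousWithinAt G (Ici 0) 0 := by
    rw [← continuousWithinAt_Ioi_iff_Ici, ContinuousWithinAt]
    have : G 0 = l := if_pos rfl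
    rw [this]
    refine hF0.congr' ?_
    filter_upwards [self_mem_nhdsWithin] with u hu using (if_neg (mem_Ioi.1 hu).ne').symm
  have hderiv : ∀ u ∈ Ioi (0 : ℝ), HasDerivAt G (subordinator s r u) u := by
    intro u hu
    have hu : 0 < u := hu
    have hsu : 0 < √u := sqrt_pos.2 hu
    refine HasDerivAt.congr_of_eventuallyEq ?_ (hGF u hu.ne')
    have d1 : HasDerivAt (fun u : ℝ => √u) (1 / (2 * √u)) u := hasDerivAt_sqrt hu.ne'
    have d2 := d1.const_mul (s / 2)
    have d3 := (d1.fun_inv hsu.ne').const_mul r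
    have d4 := (hasDerivAt_gaussPrimitive (s / 2 * √u + r * (√u)⁻¹)).comp u (d2.add d3)
    have d5 := (hasDerivAt_gaussPrimitive (s / 2 * √u - r * (√u)⁻¹)).comp u (d2.sub d3)
    have d6 := ((d4.const_mul (exp (s * r))).add (d5.const_mul (exp (-(s * r))))).const_mul (√π)⁻¹
    have e1 : exp (s * r) * exp (-(s / 2 * √u + r * (√u)⁻¹) ^ 2) =
        exp (-(s ^ 2 / 4 * u + r ^ 2 / u)) := by
      rw [← exp_add]
      congr 1
      have := sq_sqrt hu.le
      field_simp
      rw [this]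
      ring
    have e2 : exp (-(s * r)) * exp (-(s / 2 * √u - r * (√u)⁻¹) ^ 2) =
        exp (-(s ^ 2 / 4 * u + r ^ 2 / u)) := by
      rw [← exp_add]
      congr 1
      have := sq_sqrt hu.le
      field_simp
      rw [this]
      ring
    refine d6.congr_deriv ?_
    rw [← mul_assoc, ← mul_assoc, e1, e2, subordinator]
    field_simp
    ring
  have hnn : ∀ u ∈ Ioi (0 : ℝ), 0 ≤ subordinator s r u := fun u _ => subordinator_nonneg hs r u
  have hlim : Tendsto G atTop (𝓝 (l + exp (-(s * r)))) := by
    refine hFtop.congr' ?_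
    filter_upwards [eventually_gt_atTop 0] with u hu using (if_neg hu.ne').symm
  refine ⟨integrableOn_Ioi_deriv_of_nonneg hcont hderiv hnn hlim, ?_⟩
  rw [integral_Ioi_of_hasDerivAt_of_nonneg hcont hderiv hnn hlim]
  simp [hG]

/-! ### Sums over the lattice -/

/-- The Euclidean norm of an integer point. -/
noncomputable def latticeNorm (v : Fin 3 → ℤ) : ℝ :=
  ‖(WithLp.toLp 2 (fun i => (v i : ℝ)) : EuclideanSpace ℝ (Fin 3))‖

theorem latticeNorm_nonneg (v : Fin 3 → ℤ) : 0 ≤ latticeNorm v := norm_nonneg _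

theorem latticeNorm_sq (v : Fin 3 → ℤ) : latticeNorm v ^ 2 = ∑ i, (v i : ℝ) ^ 2 := by
  simp [latticeNorm, EuclideanSpace.norm_sq_eq]

theorem latticeNorm_zero : latticeNorm 0 = 0 := by
  have := latticeNorm_sq 0
  simpa using this

theorem one_le_latticeNorm {v : Fin 3 → ℤ} (hv : v ≠ 0) : 1 ≤ latticeNorm v := by
  obtain ⟨i, hi⟩ := Function.ne_iff.1 hv
  have h1 : (1 : ℝ) ≤ (v i : ℝ) ^ 2 := by
    have : (1 : ℤ) ≤ v i ^ 2 := by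
      have := Int.one_le_abs hi
      rw [← sq_abs]; nlinarith
    exact_mod_cast this
  have h2 : (v i : ℝ) ^ 2 ≤ latticeNorm v ^ 2 := by
    rw [latticeNorm_sq]
    exact Finset.single_le_sum (f := fun i => (v i : ℝ) ^ 2) (fun _ _ => sq_nonneg _)
      (Finset.mem_univ i)
  nlinarith [latticeNorm_nonneg v]

theorem latticeNorm_single : latticeNorm (Pi.single 0 1) = 1 := by
  have := latticeNorm_sq (Pi.single 0 1)
  rw [Fin.sum_univ_three] at this
  simp at this
  rcases this with h | h
  · exact h
  · linarith [latticeNorm_nonneg (Pi.single 0 1)]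

/-- The bound `ζ(1 + θ) ≤ 1 + 1 / θ ≤ 2 / θ`. The term `k = 0` is `0`, by the convention for
`0 ^ y`. -/
theorem tsum_nat_rpow_le {θ : ℝ} (h0 : 0 < θ) (h1 : θ ≤ 1) :
    ∑' k : ℕ, (k : ℝ) ^ (-(1 + θ)) ≤ 2 / θ := by
  have hs : Summable fun k : ℕ => (k : ℝ) ^ (-(1 + θ)) := summable_nat_rpow.2 (by linarith)
  rw [hs.tsum_eq_zero_add]
  have e : ∀ k : ℕ, ((k + 1 : ℕ) : ℝ) ^ (-(1 + θ)) = 1 / ((k : ℝ) + 1) ^ (1 + θ) := fun k => by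
    rw [rpow_neg (by positivity), one_div]; push_cast; rfl
  have h2 := ZetaAsymptotics.zeta_limit_aux1 (s := 1 + θ) (by linarith)
  have h3 : 0 ≤ ZetaAsymptotics.termTSum (1 + θ) :=
    tsum_nonneg fun n => ZetaAsymptotics.term_nonneg _ _
  have h4 : 1 ≤ 1 / θ := by rw [le_div_iff₀ h0]; linarith
  simp only [e]
  rw [Nat.cast_zero, zero_rpow (by linarith), zero_add]
  rw [add_sub_cancel_left] at h2
  have h5 : 2 / θ = 1 / θ + 1 / θ := by ring
  nlinarith

/-- The dependence on `θ` is what makes the choice `θ = 1 / log x` effective. The term `v = 0` is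
`0`, by the convention for `0 ^ y`. -/
theorem exists_tsum_latticeNorm_rpow_le :
    ∃ C : ℝ, 0 < C ∧ ∀ θ : ℝ, 0 < θ → θ ≤ 1 →
      (Summable fun v : Fin 3 → ℤ => latticeNorm v ^ (-(3 + θ))) ∧
      ∑' v : Fin 3 → ℤ, latticeNorm v ^ (-(3 + θ)) ≤ C / θ := by
  classical
  let b := (EuclideanSpace.basisFun (Fin 3) ℝ).toBasis
  let L := Submodule.span ℤ (Set.range b)
  have hfr : Module.finrank ℤ L = 3 := by
    rw [ZLattice.rank ℝ L]; simp
  obtain ⟨A, hA, h⟩ := ZLattice.exists_finsetSum_norm_rpow_le_tsum L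
  let e : (Fin 3 → ℤ) ≃ L := (b.restrictScalars ℤ).equivFun.symm.toEquiv
  have he : ∀ v, ‖e v‖ = latticeNorm v := by
    intro v
    have h1 : ((e v : L) : EuclideanSpace ℝ (Fin 3)) = WithLp.toLp 2 (fun i => (v i : ℝ)) := by
      have : e v = ∑ i, v i • (b.restrictScalars ℤ) i :=
        (b.restrictScalars ℤ).equivFun_symm_apply v
      rw [this]
      have h2 : ∀ i, ((v i • (b.restrictScalars ℤ) i : L) : EuclideanSpace ℝ (Fin 3)) =
          (v i : ℝ) • b i := fun i => by
        rw [Submodule.coe_smul, Module.Basis.restrictScalars_apply, Int.cast_smul_eq_zsmul]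
      rw [Submodule.coe_sum]
      simp only [h2]
      ext j
      simp [b, Pi.single_apply]
    rw [Submodule.coe_norm, h1, latticeNorm]
  refine ⟨(1 + A⁻¹) ^ (4 : ℝ) * 2, by positivity, fun θ h0 h1 => ?_⟩
  have hb : ∀ s : Finset (Fin 3 → ℤ), ∑ v ∈ s, latticeNorm v ^ (-(3 + θ)) ≤
      (1 + A⁻¹) ^ (4 : ℝ) * 2 / θ := by
    intro s
    have h2 := h (-(3 + θ)) (by rw [hfr]; push_cast; linarith) (s.map e.toEmbedding)
    rw [Finset.sum_map, hfr] at h2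
    simp only [Equiv.coe_toEmbedding, he] at h2
    refine h2.trans ?_
    have h3 : (((3 : ℕ) : ℝ) - 1 + -(3 + θ)) = -(1 + θ) := by push_cast; ring
    rw [h3, mul_div_assoc]
    refine mul_le_mul ?_ (tsum_nat_rpow_le h0 h1) (tsum_nonneg fun _ => by positivity)
      (by positivity)
    have hA' : 0 < A⁻¹ := inv_pos.2 hA
    rw [rpow_neg hA.le, ← inv_rpow hA.le]
    calc A⁻¹ ^ (3 + θ) ≤ (1 + A⁻¹) ^ (3 + θ) :=
          rpow_le_rpow hA'.le (by linarith) (by linarith)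
      _ ≤ _ := rpow_le_rpow_of_exponent_le (by linarith) (by linarith)
  have hsum := summable_of_sum_le (fun v => rpow_nonneg (latticeNorm_nonneg v) _) hb
  exact ⟨hsum, hsum.tsum_le_of_sum_le hb⟩

theorem summable_latticeNorm_inv_pow_four :
    Summable fun v : Fin 3 → ℤ => (latticeNorm v ^ 4)⁻¹ := by
  obtain ⟨C, -, h⟩ := exists_tsum_latticeNorm_rpow_le
  refine (h 1 one_pos le_rfl).1.congr fun v => ?_
  rw [rpow_neg (latticeNorm_nonneg v)]
  norm_num

theorem summable_exp_neg_mul_latticeNorm {s : ℝ} (hs : 0 < s) :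
    Summable fun v : Fin 3 → ℤ => exp (-(s * latticeNorm v)) := by
  refine Summable.of_norm_bounded_eventually
    (summable_latticeNorm_inv_pow_four.mul_left (24 / s ^ 4)) ?_
  have : {v : Fin 3 → ℤ | v = 0}.Finite := by simp
  filter_upwards [this.compl_mem_cofinite] with v hv
  have hv : 1 ≤ latticeNorm v := one_le_latticeNorm hv
  rw [norm_of_nonneg (exp_pos _).le, exp_neg]
  have h1 := pow_div_factorial_le_exp (s * latticeNorm v) (by positivity) 4
  have h2 : (0 : ℝ) < (s * latticeNorm v) ^ 4 / 24 := by positivity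
  have h3 : (exp (s * latticeNorm v))⁻¹ ≤ ((s * latticeNorm v) ^ 4 / 24)⁻¹ := by
    refine inv_anti₀ h2 (le_trans (le_of_eq ?_) h1)
    norm_num [Nat.factorial]
  refine h3.trans (le_of_eq ?_)
  field_simp

/-! ### The cube of the theta function -/

theorem hasSum_exp_neg_mul_latticeNorm_sq {c : ℝ} (hc : 0 < c) :
    HasSum (fun v : Fin 3 → ℤ => exp (-(c * latticeNorm v ^ 2)))
      ((∑' n : ℤ, exp (-c * (n : ℝ) ^ 2)) ^ 3) := by
  have hs : Summable fun n : ℤ => exp (-c * (n : ℝ) ^ 2) := by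
    have h : Summable fun n : ℕ => exp (-c * (n : ℝ) ^ 2) := by
      refine Summable.of_nonneg_of_le (fun n => (exp_pos _).le) (fun n => ?_)
        (summable_exp_nat_mul_iff.2 (neg_lt_zero.2 hc))
      rw [exp_le_exp]
      have : (n : ℝ) ≤ (n : ℝ) ^ 2 := by exact_mod_cast Nat.le_self_pow two_ne_zero n
      nlinarith
    exact Summable.of_nat_of_neg (by simpa using h) (by simpa using h)
  set f : ℤ → ℝ := fun n => exp (-c * (n : ℝ) ^ 2)
  have hf : 0 ≤ f := fun n => (exp_pos _).le
  have s2 := hs.mul_of_nonneg hs hf hf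
  have h2 := hs.hasSum.mul hs.hasSum s2
  have h3 := hs.hasSum.mul h2
    (hs.mul_of_nonneg s2 hf fun n => mul_nonneg (hf _) (hf _))
  let e : (Fin 3 → ℤ) ≃ ℤ × ℤ × ℤ :=
    (Fin.consEquiv fun _ => ℤ).symm.trans ((Equiv.refl ℤ).prodCongr (finTwoArrowEquiv ℤ))
  have h4 := e.hasSum_iff.2 h3
  rw [show tsum f ^ 3 = tsum f * (tsum f * tsum f) by ring]
  refine h4.congr_fun fun v => ?_
  have h5 : e v = (v 0, v 1, v 2) := rfl
  simp only [Function.comp_apply, h5, f, latticeNorm_sq, Fin.sum_univ_three, ← exp_add]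
  ring_nf

/-- The functional equation of the theta function, cubed. -/
theorem tsum_exp_neg_latticeNorm_sq_div {u : ℝ} (hu : 0 < u) :
    ∑' v : Fin 3 → ℤ, exp (-(latticeNorm v ^ 2 / u)) =
      √π ^ 3 * √u ^ 3 * ∑' v : Fin 3 → ℤ, exp (-(π ^ 2 * latticeNorm v ^ 2 * u)) := by
  have h1 := (hasSum_exp_neg_mul_latticeNorm_sq (c := u⁻¹) (by positivity)).tsum_eq
  have h2 := (hasSum_exp_neg_mul_latticeNorm_sq (c := π ^ 2 * u) (by positivity)).tsum_eq
  have h3 := Real.tsum_exp_neg_mul_int_sq (a := (π * u)⁻¹) (by positivity)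
  have e1 : ∀ v : Fin 3 → ℤ, -(latticeNorm v ^ 2 / u) = -(u⁻¹ * latticeNorm v ^ 2) := fun v => by
    ring
  have e2 : ∀ v : Fin 3 → ℤ, -(π ^ 2 * latticeNorm v ^ 2 * u) =
      -(π ^ 2 * u * latticeNorm v ^ 2) := fun v => by ring
  simp only [e1, e2, h1, h2]
  have e3 : -π * (π * u)⁻¹ = -u⁻¹ := by field_simp
  have e4 : -π / (π * u)⁻¹ = -(π ^ 2 * u) := by field_simp
  rw [e3, e4] at h3
  rw [h3, mul_pow, ← sqrt_eq_rpow, sqrt_inv, one_div, inv_inv, sqrt_mul pi_pos.le, mul_pow]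

/-! ### Elementary Laplace transforms -/

theorem tendsto_pow_mul_exp_neg_mul {s : ℝ} (hs : 0 < s) (n : ℕ) :
    Tendsto (fun x : ℝ => x ^ n * exp (-(s * x))) atTop (𝓝 0) := by
  refine (isLittleO_pow_exp_pos_mul_atTop n hs).tendsto_div_nhds_zero.congr fun x => ?_
  rw [exp_neg, div_eq_mul_inv]

theorem hasDerivAt_exp_neg_mul (s x : ℝ) :
    HasDerivAt (fun x : ℝ => exp (-(s * x))) (exp (-(s * x)) * (-s)) x := by
  have : HasDerivAt (fun x : ℝ => -(s * x)) (-s) x := by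
    simpa using ((hasDerivAt_id x).const_mul s).fun_neg
  exact this.exp

theorem laplace_pow {s : ℝ} (hs : 0 < s) (n : ℕ) :
    IntegrableOn (fun x : ℝ => x ^ n * exp (-(s * x))) (Ioi 0) ∧
      ∫ x in Ioi (0 : ℝ), x ^ n * exp (-(s * x)) = n.factorial / s ^ (n + 1) := by
  constructor
  · have := integrableOn_rpow_mul_exp_neg_mul_rpow (p := 1) (s := n) (b := s)
      (by have : (0 : ℝ) ≤ n := n.cast_nonneg
          linarith) one_pos hs
    simpa using this
  · have := integral_rpow_mul_exp_neg_mul_Ioi (a := n + 1) (r := s) (by positivity) hs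
    rw [Gamma_nat_eq_factorial] at this
    simp only [add_sub_cancel_right, rpow_natCast] at this
    rw [this, show (n : ℝ) + 1 = ((n + 1 : ℕ) : ℝ) by push_cast; rfl, rpow_natCast,
      one_div, inv_pow]
    field_simp

theorem laplace_mul_cos {s : ℝ} (hs : 0 < s) (k : ℝ) :
    IntegrableOn (fun x : ℝ => x * cos (k * x) * exp (-(s * x))) (Ioi 0) ∧
      ∫ x in Ioi (0 : ℝ), x * cos (k * x) * exp (-(s * x)) =
        (s ^ 2 - k ^ 2) / (s ^ 2 + k ^ 2) ^ 2 := by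
  have hint : IntegrableOn (fun x : ℝ => x * cos (k * x) * exp (-(s * x))) (Ioi 0) := by
    refine Integrable.mono' (laplace_pow hs 1).1
      (by fun_prop : Continuous _).aestronglyMeasurable ?_
    filter_upwards [ae_restrict_mem measurableSet_Ioi] with x hx
    rw [norm_mul, norm_mul, norm_of_nonneg (exp_pos _).le, norm_of_nonneg (mem_Ioi.1 hx).le,
      pow_one]
    have := abs_cos_le_one (k * x)
    rw [← norm_eq_abs] at this
    gcongr
    exact mul_le_of_le_one_right (mem_Ioi.1 hx).le this
  refine ⟨hint, ?_⟩
  have hd : s ^ 2 + k ^ 2 ≠ 0 := by positivity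
  set F : ℝ → ℝ := fun x => exp (-(s * x)) * (x * (-s * cos (k * x) + k * sin (k * x)) /
    (s ^ 2 + k ^ 2) + (-(s ^ 2 - k ^ 2) * cos (k * x) + 2 * s * k * sin (k * x)) /
    (s ^ 2 + k ^ 2) ^ 2) with hF
  have hderiv : ∀ x ∈ Ici (0 : ℝ), HasDerivAt F (x * cos (k * x) * exp (-(s * x))) x := by
    intro x _
    have d0 : HasDerivAt (fun x : ℝ => k * x) k x := by simpa using (hasDerivAt_id x).const_mul k
    have d1 := hasDerivAt_exp_neg_mul s x
    have d2 := d0.cos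
    have d3 := d0.sin
    have d4 := ((hasDerivAt_id' x).fun_mul ((d2.const_mul (-s)).fun_add (d3.const_mul k))).div_const
      (s ^ 2 + k ^ 2)
    have d5 := ((d2.const_mul (-(s ^ 2 - k ^ 2))).fun_add (d3.const_mul (2 * s * k))).div_const
      ((s ^ 2 + k ^ 2) ^ 2)
    refine (d1.fun_mul (d4.fun_add d5)).congr_deriv ?_
    field_simp
    ring
  have hlim : Tendsto F atTop (𝓝 0) := by
    have h0 := tendsto_pow_mul_exp_neg_mul hs 0
    have h1 := tendsto_pow_mul_exp_neg_mul hs 1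
    have hb : ∀ a b : ℝ, IsBoundedUnder (· ≤ ·) atTop
        (norm ∘ fun x => a * cos (k * x) + b * sin (k * x)) := by
      intro a b
      refine isBoundedUnder_of ⟨|a| + |b|, fun x => ?_⟩
      refine (norm_add_le _ _).trans (add_le_add ?_ ?_)
      · rw [norm_mul]; exact mul_le_of_le_one_right (abs_nonneg _) (abs_cos_le_one _)
      · rw [norm_mul]; exact mul_le_of_le_one_right (abs_nonneg _) (abs_sin_le_one _)
    have h2 := (h1.zero_mul_isBoundedUnder_le (hb (-s) k)).div_const (s ^ 2 + k ^ 2)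
    have h3 := (h0.zero_mul_isBoundedUnder_le (hb (-(s ^ 2 - k ^ 2)) (2 * s * k))).div_const
      ((s ^ 2 + k ^ 2) ^ 2)
    have h4 := h2.add h3
    simp only [zero_div, add_zero] at h4
    refine h4.congr fun x => ?_
    simp only [hF]
    ring
  rw [integral_Ioi_of_hasDerivAt_of_tendsto' hderiv hint hlim]
  simp [hF]
  ring

theorem laplace_sin {s : ℝ} (hs : 0 < s) (k : ℝ) :
    IntegrableOn (fun x : ℝ => sin (k * x) * exp (-(s * x))) (Ioi 0) ∧
      ∫ x in Ioi (0 : ℝ), sin (k * x) * exp (-(s * x)) = k / (s ^ 2 + k ^ 2) := by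
  have hint : IntegrableOn (fun x : ℝ => sin (k * x) * exp (-(s * x))) (Ioi 0) := by
    refine Integrable.mono' (laplace_pow hs 0).1
      (by fun_prop : Continuous _).aestronglyMeasurable ?_
    filter_upwards with x
    rw [norm_mul, norm_of_nonneg (exp_pos _).le, pow_zero]
    gcongr
    exact abs_sin_le_one _
  refine ⟨hint, ?_⟩
  have hd : s ^ 2 + k ^ 2 ≠ 0 := by positivity
  set F : ℝ → ℝ := fun x => exp (-(s * x)) * ((-s * sin (k * x) + -k * cos (k * x)) /
    (s ^ 2 + k ^ 2)) with hF
  have hderiv : ∀ x ∈ Ici (0 : ℝ), HasDerivAt F (sin (k * x) * exp (-(s * x))) x := by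
    intro x _
    have d0 : HasDerivAt (fun x : ℝ => k * x) k x := by simpa using (hasDerivAt_id x).const_mul k
    have d1 := hasDerivAt_exp_neg_mul s x
    have d2 := ((d0.sin.const_mul (-s)).fun_add (d0.cos.const_mul (-k))).div_const (s ^ 2 + k ^ 2)
    refine (d1.fun_mul d2).congr_deriv ?_
    field_simp
    ring
  have hlim : Tendsto F atTop (𝓝 0) := by
    have h0 := tendsto_pow_mul_exp_neg_mul hs 0
    simp only [pow_zero, one_mul] at h0
    refine h0.zero_mul_isBoundedUnder_le
      (isBoundedUnder_of ⟨(s + |k|) / (s ^ 2 + k ^ 2), fun x => ?_⟩)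
    rw [Function.comp_apply, norm_div, norm_of_nonneg (by positivity : 0 ≤ s ^ 2 + k ^ 2)]
    gcongr
    refine (norm_add_le _ _).trans (add_le_add ?_ ?_)
    · rw [norm_mul, norm_neg, norm_of_nonneg hs.le]
      exact mul_le_of_le_one_right hs.le (abs_sin_le_one _)
    · rw [norm_mul, norm_neg]
      exact mul_le_of_le_one_right (abs_nonneg _) (abs_cos_le_one _)
  rw [integral_Ioi_of_hasDerivAt_of_tendsto' hderiv hint hlim]
  simp [hF]
  ring

/-- The Laplace transform of the contribution of one lattice point to `iterCount 2`. -/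
theorem laplace_truncated_sq {s a : ℝ} (hs : 0 < s) (ha : 0 ≤ a) :
    IntegrableOn (fun x : ℝ => max (x - a) 0 ^ 2 / 2 * exp (-(s * x))) (Ioi 0) ∧
      ∫ x in Ioi (0 : ℝ), max (x - a) 0 ^ 2 / 2 * exp (-(s * x)) = exp (-(s * a)) / s ^ 3 := by
  set f : ℝ → ℝ := fun x => max (x - a) 0 ^ 2 / 2 * exp (-(s * x)) with hf
  have hsub : Ioi a ⊆ Ioi 0 := Ioi_subset_Ioi ha
  have hzero : ∀ x ∈ Ioi (0 : ℝ) \ Ioi a, f x = 0 := by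
    intro x hx
    have : x ≤ a := not_lt.1 hx.2
    simp [hf, max_eq_right (sub_nonpos.2 this)]
  set F : ℝ → ℝ := fun x =>
    -(exp (-(s * x)) * ((x - a) ^ 2 / (2 * s) + (x - a) / s ^ 2 + 1 / s ^ 3))
    with hF
  have hderiv : ∀ x ∈ Ici a, HasDerivAt F (f x) x := by
    intro x hx
    have d1 := hasDerivAt_exp_neg_mul s x
    have d2 : HasDerivAt (fun x : ℝ => x - a) 1 x := (hasDerivAt_id x).sub_const a
    have d3 := (((d2.fun_pow 2).div_const (2 * s)).fun_add (d2.div_const (s ^ 2))).add_const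
      (1 / s ^ 3)
    refine (d1.fun_mul d3).fun_neg.congr_deriv ?_
    simp only [hf, max_eq_left (sub_nonneg.2 (mem_Ici.1 hx))]
    field_simp
    push_cast
    ring
  have hlim : Tendsto F atTop (𝓝 0) := by
    have hsh : Tendsto (fun x : ℝ => x - a) atTop atTop :=
      tendsto_atTop_add_const_right _ _ tendsto_id
    have h := fun n => (tendsto_pow_mul_exp_neg_mul hs n).comp hsh
    have h4 := ((((h 2).div_const (2 * s)).add ((h 1).div_const (s ^ 2))).add
      ((h 0).div_const (s ^ 3))).const_mul (-exp (-(s * a)))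
    simp only [zero_div, add_zero, mul_zero] at h4
    refine h4.congr fun x => ?_
    have : exp (-(s * x)) = exp (-(s * a)) * exp (-(s * (x - a))) := by
      rw [← exp_add]; ring_nf
    simp only [hF, this, Function.comp_apply]
    ring
  have hnn : ∀ x ∈ Ioi a, 0 ≤ f x := fun x _ => by positivity
  have h1 := integrableOn_Ioi_deriv_of_nonneg' hderiv hnn hlim
  have h2 := integral_Ioi_of_hasDerivAt_of_nonneg' hderiv hnn hlim
  constructor
  · exact h1.of_forall_sdiff_eq_zero measurableSet_Ioi hzero
  · rw [setIntegral_eq_of_subset_of_forall_sdiff_eq_zero measurableSet_Ioi hsub hzero, h2]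
    simp [hF]
    ring

/-! ### The exponential sum over the lattice -/

theorem summable_resolvent {s : ℝ} (hs : 0 < s) :
    Summable fun v : Fin 3 → ℤ => 8 * π * s / (s ^ 2 + (2 * π * latticeNorm v) ^ 2) ^ 2 := by
  refine Summable.of_norm_bounded_eventually
    (summable_latticeNorm_inv_pow_four.mul_left (8 * π * s)) ?_
  have : {v : Fin 3 → ℤ | v = 0}.Finite := by simp
  filter_upwards [this.compl_mem_cofinite] with v hv
  have hv : 1 ≤ latticeNorm v := one_le_latticeNorm hv
  rw [norm_of_nonneg (by positivity), div_eq_mul_inv]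
  have hπ := pi_gt_three
  gcongr
  have h2 : latticeNorm v ^ 2 ≤ s ^ 2 + (2 * π * latticeNorm v) ^ 2 := by
    have : latticeNorm v ^ 2 ≤ (2 * π * latticeNorm v) ^ 2 := by
      gcongr; nlinarith
    nlinarith
  calc latticeNorm v ^ 4 = (latticeNorm v ^ 2) ^ 2 := by ring
    _ ≤ _ := by gcongr

/-- Poisson summation for `exp (-s|v|)`, obtained by integrating the theta identity against the
subordinator. -/
theorem tsum_exp_neg_mul_latticeNorm {s : ℝ} (hs : 0 < s) :
    ∑' v : Fin 3 → ℤ, exp (-(s * latticeNorm v)) =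
      ∑' v : Fin 3 → ℤ, 8 * π * s / (s ^ 2 + (2 * π * latticeNorm v) ^ 2) ^ 2 := by
  have hsub := fun v : Fin 3 → ℤ => subordinator_integral hs (latticeNorm_nonneg v)
  have h1 := hasSum_integral_of_summable_integral_norm
    (F := fun v : Fin 3 → ℤ => subordinator s (latticeNorm v)) (μ := volume.restrict (Ioi 0))
    (fun v => (hsub v).1) (by
      refine (summable_exp_neg_mul_latticeNorm hs).congr fun v => ?_
      simp only [norm_of_nonneg (subordinator_nonneg hs _ _), (hsub v).2])
  set K : (Fin 3 → ℤ) → ℝ → ℝ := fun v u =>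
    s * π / 2 * (u ^ 1 * exp (-((s ^ 2 / 4 + π ^ 2 * latticeNorm v ^ 2) * u))) with hK
  have hKi : ∀ v, IntegrableOn (K v) (Ioi 0) ∧ ∫ u in Ioi (0 : ℝ), K v u =
      8 * π * s / (s ^ 2 + (2 * π * latticeNorm v) ^ 2) ^ 2 := by
    intro v
    have := laplace_pow (s := s ^ 2 / 4 + π ^ 2 * latticeNorm v ^ 2) (by positivity) 1
    refine ⟨this.1.const_mul _, ?_⟩
    simp only [hK]
    rw [integral_const_mul, this.2]
    have : s ^ 2 / 4 + π ^ 2 * latticeNorm v ^ 2 = (s ^ 2 + (2 * π * latticeNorm v) ^ 2) / 4 := by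
      ring
    rw [this]
    have : s ^ 2 + (2 * π * latticeNorm v) ^ 2 ≠ 0 := by positivity
    rw [Nat.factorial_one, Nat.cast_one, one_add_one_eq_two, div_pow]
    field_simp
    norm_num
  have h2 := hasSum_integral_of_summable_integral_norm
    (F := K) (μ := volume.restrict (Ioi 0)) (fun v => (hKi v).1) (by
      refine (summable_resolvent hs).congr fun v => ?_
      rw [← (hKi v).2]
      refine setIntegral_congr_fun measurableSet_Ioi fun u hu => ?_
      have hu : 0 < u := hu
      exact (norm_of_nonneg (by simp only [hK]; positivity)).symm)
  have h3 : ∫ u in Ioi (0 : ℝ), ∑' v : Fin 3 → ℤ, subordinator s (latticeNorm v) u =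
      ∫ u in Ioi (0 : ℝ), ∑' v, K v u := by
    refine setIntegral_congr_fun measurableSet_Ioi fun u hu => ?_
    have hu : 0 < u := hu
    have e1 : ∀ v : Fin 3 → ℤ, subordinator s (latticeNorm v) u =
        s / (2 * √π) * (√u)⁻¹ * exp (-(s ^ 2 / 4 * u)) * exp (-(latticeNorm v ^ 2 / u)) := by
      intro v
      rw [subordinator, neg_add, exp_add]
      ring
    have e2 : ∀ v : Fin 3 → ℤ, K v u =
        s * π / 2 * u * exp (-(s ^ 2 / 4 * u)) * exp (-(π ^ 2 * latticeNorm v ^ 2 * u)) := by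
      intro v
      simp only [hK]
      rw [add_mul, neg_add, exp_add]
      ring
    simp only [e1, e2, tsum_mul_left]
    rw [tsum_exp_neg_latticeNorm_sq_div hu, ← mul_assoc]
    congr 1
    have a1 := sq_sqrt pi_pos.le
    have a2 := sq_sqrt hu.le
    have b1 : 0 < √π := sqrt_pos.2 pi_pos
    have b2 : 0 < √u := sqrt_pos.2 hu
    field_simp
    rw [a1, a2, mul_comm]
  calc _ = ∫ u in Ioi (0 : ℝ), ∑' v : Fin 3 → ℤ, subordinator s (latticeNorm v) u := by
        rw [← h1.tsum_eq]
        exact tsum_congr fun v => (hsub v).2.symm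
    _ = _ := by
        rw [h3, ← h2.tsum_eq]
        exact tsum_congr fun v => (hKi v).2

/-! ### Iterated integrals of the counting function as sums over the lattice -/

theorem integral_indicator_le {a r : ℝ} (ha : 0 ≤ a) :
    ∫ t in (0 : ℝ)..r, (if a ≤ t then (1 : ℝ) else 0) = max (r - a) 0 := by
  have h := integral_eq_of_hasDerivAt_off_countable (a := 0) (b := r) (s := {a})
    (fun t => max (t - a) 0) (fun t => if a ≤ t then (1 : ℝ) else 0) (countable_singleton a)
    (by fun_prop) (fun t ht => ?_) ?_
  · rw [h]; simp [ha]
  · rcases lt_or_gt_of_ne (show t ≠ a from ht.2) with hta | hta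
    · rw [if_neg (not_le.2 hta)]
      refine (hasDerivAt_const t (0 : ℝ)).congr_of_eventuallyEq ?_
      filter_upwards [gt_mem_nhds hta] with z hz using max_eq_right (by linarith)
    · rw [if_pos hta.le]
      refine ((hasDerivAt_id t).sub_const a).congr_of_eventuallyEq ?_
      filter_upwards [lt_mem_nhds hta] with z hz using max_eq_left (by simp; linarith)
  · refine Monotone.intervalIntegrable fun x y hxy => ?_
    split_ifs <;> linarith

theorem integral_truncated {a r : ℝ} (ha : 0 ≤ a) :
    ∫ t in (0 : ℝ)..r, max (t - a) 0 = max (r - a) 0 ^ 2 / 2 := by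
  have hc : Continuous fun t : ℝ => max (t - a) 0 := by fun_prop
  have h := integral_eq_of_hasDerivAt_off_countable (a := 0) (b := r) (s := {a})
    (fun t => max (t - a) 0 ^ 2 / 2) (fun t => max (t - a) 0) (countable_singleton a)
    (by fun_prop) (fun t ht => ?_) (hc.intervalIntegrable _ _)
  · rw [h]; simp [ha]
  · rcases lt_or_gt_of_ne (show t ≠ a from ht.2) with hta | hta
    · rw [max_eq_right (by linarith)]
      refine (hasDerivAt_const t (0 : ℝ)).congr_of_eventuallyEq ?_
      filter_upwards [gt_mem_nhds hta] with z hz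
      rw [max_eq_right (by linarith)]
      norm_num
    · rw [max_eq_left (by linarith)]
      have h1 := ((((hasDerivAt_id' t).sub_const a).fun_pow 2).div_const 2).congr_deriv
        (g' := t - a) (by push_cast; ring)
      refine h1.congr_of_eventuallyEq ?_
      filter_upwards [lt_mem_nhds hta] with z hz
      rw [max_eq_left (by linarith)]

/-- The bound `R` is kept apart from `r`, so that the index set stays fixed when the identity is
integrated over `r ≤ R`. -/
theorem iterCount_zero_eq {r R : ℝ} (h : r ≤ R) :
    iterCount 0 r = ∑ v ∈ (latticeBall_finite 3 R).toFinset,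
      if latticeNorm v ≤ r then (1 : ℝ) else 0 := by
  classical
  have h1 : latticeBall 3 r =
      ((latticeBall_finite 3 R).toFinset.filter fun v => latticeNorm v ≤ r : Finset _) := by
    ext v
    simp only [Finset.coe_filter, Finite.mem_toFinset, mem_ofPred_eq]
    exact ⟨fun hv => ⟨le_trans hv h, hv⟩, fun hv => hv.2⟩
  simp only [iterCount, latticeCount]
  rw [h1, ncard_coe_finset, Finset.sum_ite, Finset.sum_const, Finset.sum_const_zero]
  simp

theorem iterCount_one_eq {r R : ℝ} (h0 : 0 ≤ r) (h : r ≤ R) :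
    iterCount 1 r = ∑ v ∈ (latticeBall_finite 3 R).toFinset, max (r - latticeNorm v) 0 := by
  have h1 : iterCount 1 r = ∫ t in (0 : ℝ)..r, ∑ v ∈ (latticeBall_finite 3 R).toFinset,
      if latticeNorm v ≤ t then (1 : ℝ) else 0 := by
    refine intervalIntegral.integral_congr fun t ht => iterCount_zero_eq ?_
    rw [uIcc_of_le h0] at ht
    exact ht.2.trans h
  rw [h1, intervalIntegral.integral_finsetSum]
  · exact Finset.sum_congr rfl fun v _ => integral_indicator_le (latticeNorm_nonneg v)
  · refine fun v _ => Monotone.intervalIntegrable fun x y hxy => ?_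
    split_ifs <;> linarith

theorem iterCount_two_eq {r R : ℝ} (h0 : 0 ≤ r) (h : r ≤ R) :
    iterCount 2 r = ∑ v ∈ (latticeBall_finite 3 R).toFinset, max (r - latticeNorm v) 0 ^ 2 / 2 := by
  have h1 : iterCount 2 r = ∫ t in (0 : ℝ)..r, ∑ v ∈ (latticeBall_finite 3 R).toFinset,
      max (t - latticeNorm v) 0 := by
    refine intervalIntegral.integral_congr fun t ht => ?_
    rw [uIcc_of_le h0] at ht
    exact iterCount_one_eq ht.1 (ht.2.trans h)
  rw [h1, intervalIntegral.integral_finsetSum]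
  · exact Finset.sum_congr rfl fun v _ => integral_truncated (latticeNorm_nonneg v)
  · refine fun v _ => Continuous.intervalIntegrable ?_ _ _
    fun_prop

theorem hasSum_iterCount_two {x : ℝ} (hx : 0 ≤ x) :
    HasSum (fun v : Fin 3 → ℤ => max (x - latticeNorm v) 0 ^ 2 / 2) (iterCount 2 x) := by
  rw [iterCount_two_eq hx le_rfl]
  refine hasSum_sum_of_ne_finset_zero fun v hv => ?_
  have : ¬ latticeNorm v ≤ x := fun h => hv ((latticeBall_finite 3 x).mem_toFinset.2 h)
  simp [max_eq_right (sub_nonpos.2 (not_le.1 this).le)]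

theorem continuous_iterCount_one : Continuous (iterCount 1) :=
  intervalIntegral.continuous_primitive iterCount_zero_intervalIntegrable 0

theorem continuous_iterCount_two : Continuous (iterCount 2) :=
  intervalIntegral.continuous_primitive
    (fun _ _ => continuous_iterCount_one.intervalIntegrable _ _) 0

theorem iterCount_one_mono {x y : ℝ} (hx : 0 ≤ x) (hxy : x ≤ y) :
    iterCount 1 x ≤ iterCount 1 y := by
  rw [iterCount_one_eq hx hxy, iterCount_one_eq (hx.trans hxy) le_rfl]
  gcongr

theorem iterCount_two_sub (x y : ℝ) :
    iterCount 2 y - iterCount 2 x = ∫ t in x..y, iterCount 1 t :=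
  intervalIntegral.integral_interval_sub_left
    (continuous_iterCount_one.intervalIntegrable _ _)
    (continuous_iterCount_one.intervalIntegrable _ _)

theorem tendsto_iterCount_two_mul_exp :
    Tendsto (fun x => iterCount 2 x * exp (-x)) atTop (𝓝 0) := by
  have hs := (summable_exp_neg_mul_latticeNorm (s := 1 / 2) (by norm_num))
  have h1 : ∀ x : ℝ, 0 ≤ x → iterCount 2 x ≤
      ∑' v : Fin 3 → ℤ, 4 * exp (1 / 2 * x) * exp (-(1 / 2 * latticeNorm v)) := by
    intro x hx
    refine hasSum_le (fun v => ?_) (hasSum_iterCount_two hx) (hs.mul_left _).hasSum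
    have hy := exp_add (1 / 2 * x) (-(1 / 2 * latticeNorm v))
    rw [mul_assoc, ← hy]
    rcases le_total (x - latticeNorm v) 0 with h | h
    · rw [max_eq_right h]; norm_num; positivity
    · rw [max_eq_left h]
      have := quadratic_le_exp_of_nonneg (x := 1 / 2 * x + -(1 / 2 * latticeNorm v)) (by linarith)
      nlinarith
  simp only [tsum_mul_left] at h1
  set M := ∑' v : Fin 3 → ℤ, exp (-(1 / 2 * latticeNorm v))
  have h2 := ((tendsto_pow_mul_exp_neg_mul (s := 1 / 2) (by norm_num) 0).const_mul (4 * M))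
  rw [mul_zero] at h2
  refine squeeze_zero' ?_ ?_ h2
  · filter_upwards [eventually_ge_atTop 0] with x hx
    rw [← (hasSum_iterCount_two hx).tsum_eq]
    exact mul_nonneg (tsum_nonneg fun v => by positivity) (exp_pos _).le
  · filter_upwards [eventually_ge_atTop 0] with x hx
    refine (mul_le_mul_of_nonneg_right (h1 x hx) (exp_pos _).le).trans (le_of_eq ?_)
    have : exp (-(1 / 2 * x)) = exp (1 / 2 * x) * exp (-x) := by rw [← exp_add]; ring_nf
    rw [this]
    ring

theorem laplace_iterCount_two {s : ℝ} (hs : 0 < s) :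
    IntegrableOn (fun x => iterCount 2 x * exp (-(s * x))) (Ioi 0) ∧
    ∫ x in Ioi (0 : ℝ), iterCount 2 x * exp (-(s * x)) =
      (∑' v : Fin 3 → ℤ, exp (-(s * latticeNorm v))) / s ^ 3 := by
  have hL := fun v : Fin 3 → ℤ => laplace_truncated_sq hs (latticeNorm_nonneg v)
  have hsum := summable_exp_neg_mul_latticeNorm hs
  have h1 := hasSum_integral_of_summable_integral_norm (μ := volume.restrict (Ioi 0))
    (fun v => (hL v).1) (by
      refine (hsum.div_const (s ^ 3)).congr fun v => ?_
      rw [← (hL v).2]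
      exact integral_congr_ae (ae_of_all _ fun x => (norm_of_nonneg (by positivity)).symm))
  have h2 : ∫ x in Ioi (0 : ℝ), iterCount 2 x * exp (-(s * x)) =
      (∑' v : Fin 3 → ℤ, exp (-(s * latticeNorm v))) / s ^ 3 := by
    rw [← tsum_div_const, ← tsum_congr fun v => (hL v).2, h1.tsum_eq]
    refine setIntegral_congr_fun measurableSet_Ioi fun x hx => ?_
    rw [tsum_mul_right, (hasSum_iterCount_two (mem_Ioi.1 hx).le).tsum_eq]
  refine ⟨not_imp_comm.1 integral_undef ?_, h2⟩
  rw [h2]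
  exact (div_pos (hsum.tsum_pos (fun v => (exp_pos _).le) 0 (exp_pos _)) (by positivity)).ne'

/-! ### The dual expansion -/

/-- The angular frequency `2π|ξ|` of a point `ξ` of the dual lattice `ℤ³`. -/
noncomputable def freq (v : Fin 3 → ℤ) : ℝ := 2 * π * latticeNorm v

theorem freq_zero : freq 0 = 0 := by simp [freq, latticeNorm_zero]

theorem freq_nonneg (v : Fin 3 → ℤ) : 0 ≤ freq v :=
  mul_nonneg (by positivity) (latticeNorm_nonneg v)

theorem latticeNorm_le_freq (v : Fin 3 → ℤ) : latticeNorm v ≤ freq v := by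
  rw [freq]
  nlinarith [pi_gt_three, latticeNorm_nonneg v]

theorem one_le_freq {v : Fin 3 → ℤ} (hv : v ≠ 0) : 1 ≤ freq v :=
  (one_le_latticeNorm hv).trans (latticeNorm_le_freq v)

theorem inv_freq_pow_four_le (v : Fin 3 → ℤ) : (freq v ^ 4)⁻¹ ≤ (latticeNorm v ^ 4)⁻¹ := by
  rcases eq_or_ne v 0 with rfl | hv
  · simp [freq_zero, latticeNorm_zero]
  · have := one_le_latticeNorm hv
    have := latticeNorm_le_freq v
    gcongr

theorem summable_inv_freq_pow_four : Summable fun v => (freq v ^ 4)⁻¹ :=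
  Summable.of_nonneg_of_le (fun v => by have := freq_nonneg v; positivity) inv_freq_pow_four_le
    summable_latticeNorm_inv_pow_four

/-- The oscillating part `x (2 + cos kx) / k⁴ - 3 sin kx / k⁵` of the contribution of a non-zero
dual lattice point, `k = 2π|ξ|`. It vanishes for `ξ = 0`, by the convention `y / 0 = 0`. -/
noncomputable def wave (v : Fin 3 → ℤ) (x : ℝ) : ℝ :=
  x * ((2 + cos (freq v * x)) / freq v ^ 4) - 3 * (sin (freq v * x) / freq v ^ 5)

/-- The sum of `(2 + cos kx) / k⁴` over the dual lattice; the term of `ξ = 0` vanishes, by the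
convention `y / 0 = 0`. -/
noncomputable def cosSum (x : ℝ) : ℝ := ∑' v, (2 + cos (freq v * x)) / freq v ^ 4

/-- The sum of `sin kx / k⁵` over the dual lattice; the term of `ξ = 0` vanishes, as for
`cosSum`. -/
noncomputable def sinSum (x : ℝ) : ℝ := ∑' v, sin (freq v * x) / freq v ^ 5

theorem norm_cosTerm_le (v : Fin 3 → ℤ) (x : ℝ) :
    ‖(2 + cos (freq v * x)) / freq v ^ 4‖ ≤ 3 * (freq v ^ 4)⁻¹ := by
  have := freq_nonneg v
  rw [div_eq_mul_inv, norm_mul, norm_of_nonneg (by positivity : 0 ≤ (freq v ^ 4)⁻¹)]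
  gcongr
  rw [norm_eq_abs, abs_le]
  constructor <;> linarith [cos_le_one (freq v * x), neg_one_le_cos (freq v * x)]

theorem norm_sinTerm_le (v : Fin 3 → ℤ) (x : ℝ) :
    ‖sin (freq v * x) / freq v ^ 5‖ ≤ 1 * (freq v ^ 4)⁻¹ := by
  rcases eq_or_ne v 0 with rfl | hv
  · simp [freq_zero]
  have h := one_le_freq hv
  rw [div_eq_mul_inv, norm_mul, norm_of_nonneg (by positivity : 0 ≤ (freq v ^ 5)⁻¹)]
  have : freq v ^ 4 ≤ freq v ^ 5 := pow_le_pow_right₀ h (by norm_num)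
  gcongr
  exact abs_sin_le_one _

theorem norm_sinTerm_le_mul (v : Fin 3 → ℤ) {x : ℝ} (hx : 0 ≤ x) :
    ‖sin (freq v * x) / freq v ^ 5‖ ≤ x * (freq v ^ 4)⁻¹ := by
  rcases eq_or_ne v 0 with rfl | hv
  · simp [freq_zero]
  have h := one_le_freq hv
  rw [norm_div, norm_of_nonneg (by positivity : 0 ≤ freq v ^ 5)]
  calc _ ≤ freq v * x / freq v ^ 5 := by
        gcongr
        have := abs_sin_le_abs (x := freq v * x)
        rwa [abs_of_nonneg (by positivity : 0 ≤ freq v * x)] at this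
    _ = _ := by field_simp

theorem summable_cosTerm (x : ℝ) : Summable fun v => (2 + cos (freq v * x)) / freq v ^ 4 :=
  Summable.of_norm_bounded (summable_inv_freq_pow_four.mul_left 3) fun v => norm_cosTerm_le v x

theorem summable_sinTerm (x : ℝ) : Summable fun v => sin (freq v * x) / freq v ^ 5 :=
  Summable.of_norm_bounded (summable_inv_freq_pow_four.mul_left 1) fun v => norm_sinTerm_le v x

theorem continuous_cosSum : Continuous cosSum :=
  continuous_tsum (fun v => by fun_prop) (summable_inv_freq_pow_four.mul_left 3) norm_cosTerm_le

theorem continuous_sinSum : Continuous sinSum :=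
  continuous_tsum (fun v => by fun_prop) (summable_inv_freq_pow_four.mul_left 1) norm_sinTerm_le

theorem abs_cosSum_le (x : ℝ) : |cosSum x| ≤ 3 * ∑' v, (freq v ^ 4)⁻¹ := by
  rw [← tsum_mul_left]
  exact tsum_of_norm_bounded (summable_inv_freq_pow_four.mul_left 3).hasSum
    fun v => norm_cosTerm_le v x

theorem abs_sinSum_le (x : ℝ) : |sinSum x| ≤ ∑' v, (freq v ^ 4)⁻¹ := by
  have := tsum_of_norm_bounded (summable_inv_freq_pow_four.mul_left 1).hasSum
    fun v => norm_sinTerm_le v x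
  rwa [tsum_mul_left, one_mul] at this

theorem hasSum_wave (x : ℝ) : HasSum (fun v => wave v x) (x * cosSum x - 3 * sinSum x) :=
  ((summable_cosTerm x).hasSum.mul_left x).sub ((summable_sinTerm x).hasSum.mul_left 3)

theorem norm_wave_le (v : Fin 3 → ℤ) {x : ℝ} (hx : 0 ≤ x) :
    ‖wave v x‖ ≤ 6 * x * (freq v ^ 4)⁻¹ := by
  refine (norm_sub_le _ _).trans ?_
  rw [norm_mul, norm_mul, norm_of_nonneg hx, norm_of_nonneg (by norm_num : (0 : ℝ) ≤ 3)]
  nlinarith [norm_cosTerm_le v x, norm_sinTerm_le_mul v hx]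

theorem laplace_wave {s : ℝ} (hs : 0 < s) {v : Fin 3 → ℤ} (hv : v ≠ 0) :
    IntegrableOn (fun x => wave v x * exp (-(s * x))) (Ioi 0) ∧
      ∫ x in Ioi (0 : ℝ), wave v x * exp (-(s * x)) =
        2 / (s ^ 2 * (s ^ 2 + freq v ^ 2) ^ 2) := by
  have hk : 0 < freq v := zero_lt_one.trans_le (one_le_freq hv)
  have h1 := laplace_pow hs 1
  have h2 := laplace_mul_cos hs (freq v)
  have h3 := laplace_sin hs (freq v)
  have e : (fun x => wave v x * exp (-(s * x))) = fun x =>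
      2 / freq v ^ 4 * (x ^ 1 * exp (-(s * x))) +
      1 / freq v ^ 4 * (x * cos (freq v * x) * exp (-(s * x))) -
      3 / freq v ^ 5 * (sin (freq v * x) * exp (-(s * x))) := by
    funext x
    rw [wave]
    ring
  have h12 : IntegrableOn (fun x => 2 / freq v ^ 4 * (x ^ 1 * exp (-(s * x))) +
      1 / freq v ^ 4 * (x * cos (freq v * x) * exp (-(s * x)))) (Ioi 0) :=
    (h1.1.const_mul _).add (h2.1.const_mul _)
  rw [e]
  refine ⟨h12.sub (h3.1.const_mul _), ?_⟩
  rw [integral_sub h12 (h3.1.const_mul _), integral_add (h1.1.const_mul _) (h2.1.const_mul _),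
    integral_const_mul, integral_const_mul,
    integral_const_mul, h1.2, h2.2, h3.2, Nat.factorial_one, Nat.cast_one]
  field_simp
  ring

/-- Termwise Laplace transform of the dual expansion. -/
theorem laplace_tsum_wave {s : ℝ} (hs : 0 < s) :
    IntegrableOn (fun x => (x * cosSum x - 3 * sinSum x) * exp (-(s * x))) (Ioi 0) ∧
    ∫ x in Ioi (0 : ℝ), (x * cosSum x - 3 * sinSum x) * exp (-(s * x)) =
      ∑' v : Fin 3 → ℤ, if v = 0 then 0 else 2 / (s ^ 2 * (s ^ 2 + freq v ^ 2) ^ 2) := by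
  have hp := laplace_pow hs 1
  have hw0 : ∀ x, wave 0 x = 0 := fun x => by simp [wave, freq_zero]
  have hL : ∀ v, IntegrableOn (fun x => wave v x * exp (-(s * x))) (Ioi 0) ∧
      ∫ x in Ioi (0 : ℝ), wave v x * exp (-(s * x)) =
        if v = 0 then 0 else 2 / (s ^ 2 * (s ^ 2 + freq v ^ 2) ^ 2) := by
    intro v
    split_ifs with hv
    · subst hv; simp [hw0]
    · exact laplace_wave hs hv
  constructor
  · set M := ∑' v, (freq v ^ 4)⁻¹
    refine Integrable.mono' (g := fun x => 6 * M * (x ^ 1 * exp (-(s * x))))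
      (hp.1.const_mul _) ?_ ?_
    · have := continuous_cosSum
      have := continuous_sinSum
      exact (by fun_prop : Continuous _).aestronglyMeasurable
    · filter_upwards [ae_restrict_mem measurableSet_Ioi] with x hx
      rw [norm_mul, norm_of_nonneg (exp_pos _).le, ← mul_assoc, pow_one]
      gcongr
      have := tsum_of_norm_bounded (summable_inv_freq_pow_four.mul_left (6 * x)).hasSum
        fun v => norm_wave_le v (mem_Ioi.1 hx).le
      rw [(hasSum_wave x).tsum_eq, tsum_mul_left] at this
      linarith
  · have h1 := hasSum_integral_of_summable_integral_norm (μ := volume.restrict (Ioi 0))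
      (fun v => (hL v).1) (by
        refine Summable.of_nonneg_of_le (fun v => integral_nonneg fun x => norm_nonneg _)
          (fun v => ?_) (summable_inv_freq_pow_four.mul_left (6 * (1 / s ^ 2)))
        have : 6 * (1 / s ^ 2) * (freq v ^ 4)⁻¹ =
            ∫ x in Ioi (0 : ℝ), 6 * (freq v ^ 4)⁻¹ * (x ^ 1 * exp (-(s * x))) := by
          rw [integral_const_mul, hp.2]; simp; ring
        rw [this]
        refine setIntegral_mono_on (hL v).1.norm (hp.1.const_mul _) measurableSet_Ioi fun x hx => ?_
        rw [norm_mul, norm_of_nonneg (exp_pos _).le, ← mul_assoc, pow_one]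
        gcongr
        linarith [norm_wave_le v (mem_Ioi.1 hx).le])
    rw [← tsum_congr fun v => (hL v).2, h1.tsum_eq]
    refine setIntegral_congr_fun measurableSet_Ioi fun x _ => ?_
    rw [tsum_mul_right, (hasSum_wave x).tsum_eq]

/-- The explicit formula: both sides are continuous and have the same Laplace transform. The first
term is the contribution of the dual lattice point `0`. -/
theorem iterCount_two_eq_expansion {x : ℝ} (hx : 0 < x) :
    iterCount 2 x = π / 15 * x ^ 5 + 4 * π * (x * cosSum x - 3 * sinSum x) := by
  have hcc := continuous_cosSum
  have hcs := continuous_sinSum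
  have hci := continuous_iterCount_two
  have hlim : Tendsto (fun x => (π / 15 * x ^ 5 + 4 * π * (x * cosSum x - 3 * sinSum x)) * exp (-x))
      atTop (𝓝 0) := by
    have h := tendsto_pow_mul_exp_neg_mul one_pos
    have hb : IsBoundedUnder (· ≤ ·) atTop (norm ∘ cosSum) :=
      isBoundedUnder_of ⟨_, abs_cosSum_le⟩
    have hb' : IsBoundedUnder (· ≤ ·) atTop (norm ∘ sinSum) :=
      isBoundedUnder_of ⟨_, abs_sinSum_le⟩
    have h1 := ((h 5).const_mul (π / 15)).add
      ((((h 1).zero_mul_isBoundedUnder_le hb).sub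
        (((h 0).zero_mul_isBoundedUnder_le hb').const_mul 3)).const_mul (4 * π))
    simp only [mul_zero, sub_zero, add_zero] at h1
    refine h1.congr fun x => ?_
    rw [one_mul]
    ring
  have hD := eqOn_zero_of_laplace_eq_zero
    (f := fun x => iterCount 2 x - (π / 15 * x ^ 5 + 4 * π * (x * cosSum x - 3 * sinSum x)))
    (by fun_prop) (by
      have := tendsto_iterCount_two_mul_exp.sub hlim
      rw [sub_zero] at this
      exact this.congr fun x => by ring) (fun n => ?_) x hx
  · linarith
  have hs : (0 : ℝ) < ((n + 2 : ℕ) : ℝ) := by positivity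
  set s : ℝ := ((n + 2 : ℕ) : ℝ)
  have hp := laplace_pow hs 5
  have hw := laplace_tsum_wave hs
  have hi := laplace_iterCount_two hs
  have hr := summable_resolvent hs
  have hsplit := hr.tsum_eq_add_tsum_ite 0
  rw [tsum_exp_neg_mul_latticeNorm hs, hsplit] at hi
  have hcongr : (∑' v : Fin 3 → ℤ,
      if v = 0 then 0 else 8 * π * s / (s ^ 2 + (2 * π * latticeNorm v) ^ 2) ^ 2) =
      4 * π * s ^ 3 *
        ∑' v : Fin 3 → ℤ, if v = 0 then 0 else 2 / (s ^ 2 * (s ^ 2 + freq v ^ 2) ^ 2) := by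
    rw [← tsum_mul_left]
    refine tsum_congr fun v => ?_
    split_ifs
    · simp
    · have : s ^ 2 + freq v ^ 2 ≠ 0 := by positivity
      change 8 * π * s / (s ^ 2 + freq v ^ 2) ^ 2 = _
      field_simp
      ring
  have e : ∀ x : ℝ, (iterCount 2 x - (π / 15 * x ^ 5 + 4 * π * (x * cosSum x - 3 * sinSum x))) *
      exp (-s * x) = iterCount 2 x * exp (-(s * x)) - (π / 15 * (x ^ 5 * exp (-(s * x))) +
        4 * π * ((x * cosSum x - 3 * sinSum x) * exp (-(s * x)))) := fun x => by
    rw [neg_mul]; ring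
  have hpw : IntegrableOn (fun x => π / 15 * (x ^ 5 * exp (-(s * x))) +
      4 * π * ((x * cosSum x - 3 * sinSum x) * exp (-(s * x)))) (Ioi 0) :=
    (hp.1.const_mul _).add (hw.1.const_mul _)
  simp only [e]
  rw [integral_sub hi.1 hpw, integral_add (hp.1.const_mul _) (hw.1.const_mul _),
    integral_const_mul, integral_const_mul, hi.2, hp.2, hw.2, hcongr, latticeNorm_zero]
  norm_num [Nat.factorial]
  field_simp
  ring

/-! ### The upper bound -/

theorem hasDerivAt_wave (v : Fin 3 → ℤ) (x : ℝ) :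
    HasDerivAt (wave v) ((2 + cos (freq v * x)) / freq v ^ 4 +
      x * (-sin (freq v * x) * freq v / freq v ^ 4) -
      3 * (cos (freq v * x) * freq v / freq v ^ 5)) x := by
  have d0 : HasDerivAt (fun x : ℝ => freq v * x) (freq v) x := by
    simpa using (hasDerivAt_id x).const_mul (freq v)
  have d1 := (hasDerivAt_id' x).fun_mul ((d0.cos.const_add 2).div_const (freq v ^ 4))
  have d2 := (d0.sin.div_const (freq v ^ 5)).const_mul 3
  refine (d1.fun_sub d2).congr_deriv ?_
  ring

/-- The mean value inequality; effective for `|v| ≤ 1 / η`. -/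
theorem abs_wave_sub_le {v : Fin 3 → ℤ} (hv : v ≠ 0) {y η : ℝ} (hy : 1 ≤ y) (h0 : 0 < η)
    (h1 : η ≤ 1) : |wave v (y + η) - wave v y| ≤ 18 * y * (η * (latticeNorm v ^ 3)⁻¹) := by
  have hn := one_le_latticeNorm hv
  have hk := one_le_freq hv
  have hnk := latticeNorm_le_freq v
  have hinv : (freq v ^ 4)⁻¹ ≤ (freq v ^ 3)⁻¹ := by
    have := pow_le_pow_right₀ hk (show 3 ≤ 4 by norm_num)
    gcongr
  have hb : ∀ x ∈ Icc y (y + η), ‖(2 + cos (freq v * x)) / freq v ^ 4 +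
      x * (-sin (freq v * x) * freq v / freq v ^ 4) -
      3 * (cos (freq v * x) * freq v / freq v ^ 5)‖ ≤ 18 * y * (freq v ^ 3)⁻¹ := by
    intro x hx
    have e : (2 + cos (freq v * x)) / freq v ^ 4 +
      x * (-sin (freq v * x) * freq v / freq v ^ 4) -
      3 * (cos (freq v * x) * freq v / freq v ^ 5) =
      (2 - 2 * cos (freq v * x)) * (freq v ^ 4)⁻¹ + -(x * sin (freq v * x)) * (freq v ^ 3)⁻¹ := by
      field_simp
      ring
    rw [e]
    have hx0 : 0 ≤ x := by linarith [hx.1]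
    have c1 : |2 - 2 * cos (freq v * x)| ≤ 4 := by
      rw [abs_le]
      constructor <;> linarith [cos_le_one (freq v * x), neg_one_le_cos (freq v * x)]
    have c2 : |-(x * sin (freq v * x))| ≤ 2 * y := by
      rw [abs_neg, abs_mul, abs_of_nonneg hx0]
      exact (mul_le_of_le_one_right hx0 (abs_sin_le_one _)).trans (by linarith [hx.2])
    have hp : 0 ≤ (freq v ^ 3)⁻¹ := by positivity
    calc _ ≤ 4 * (freq v ^ 4)⁻¹ + 2 * y * (freq v ^ 3)⁻¹ := by
          refine (norm_add_le _ _).trans ?_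
          rw [norm_mul, norm_mul, norm_of_nonneg hp,
            norm_of_nonneg (by positivity : 0 ≤ (freq v ^ 4)⁻¹)]
          exact add_le_add (mul_le_mul_of_nonneg_right c1 (by positivity))
            (mul_le_mul_of_nonneg_right c2 hp)
      _ ≤ 18 * y * (freq v ^ 3)⁻¹ := by nlinarith
  have h := (convex_Icc y (y + η)).norm_image_sub_le_of_norm_hasDerivWithin_le
    (fun x _ => (hasDerivAt_wave v x).hasDerivWithinAt) hb
    (left_mem_Icc.2 (by linarith)) (right_mem_Icc.2 (by linarith))
  rw [add_sub_cancel_left, norm_of_nonneg h0.le] at h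
  refine h.trans ?_
  have : (freq v ^ 3)⁻¹ ≤ (latticeNorm v ^ 3)⁻¹ := by gcongr
  nlinarith [mul_le_mul_of_nonneg_left this (by positivity : 0 ≤ 18 * y * η)]

/-- The trivial bound, effective for `|v| ≥ 1 / η`. -/
theorem abs_wave_sub_le' {v : Fin 3 → ℤ} {y η : ℝ} (hy : 1 ≤ y) (h0 : 0 < η)
    (h1 : η ≤ 1) : |wave v (y + η) - wave v y| ≤ 18 * y * (latticeNorm v ^ 4)⁻¹ := by
  have a1 := norm_wave_le v (by linarith : 0 ≤ y + η)
  have a2 := norm_wave_le v (by linarith : 0 ≤ y)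
  have a3 := inv_freq_pow_four_le v
  have a4 : 0 ≤ (latticeNorm v ^ 4)⁻¹ := by have := latticeNorm_nonneg v; positivity
  refine (abs_sub _ _).trans ?_
  simp only [norm_eq_abs] at a1 a2
  nlinarith

/-- Interpolation between the two preceding bounds. -/
theorem abs_wave_sub_le_rpow {v : Fin 3 → ℤ} (hv : v ≠ 0) {y η θ : ℝ} (hy : 1 ≤ y) (h0 : 0 < η)
    (h1 : η ≤ 1) (hθ : 0 < θ) (hθ1 : θ ≤ 1) :
    |wave v (y + η) - wave v y| ≤ 18 * y * (η ^ (1 - θ) * latticeNorm v ^ (-(3 + θ))) := by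
  have hn := one_le_latticeNorm hv
  have hn0 : 0 < latticeNorm v := by linarith
  have e : η ^ (1 - θ) * latticeNorm v ^ (-(3 + θ)) =
      η * (latticeNorm v ^ 3)⁻¹ * (η * latticeNorm v) ^ (-θ) := by
    rw [mul_rpow h0.le hn0.le, sub_eq_add_neg, rpow_add h0, neg_add, rpow_add hn0, rpow_one,
      rpow_neg hn0.le 3]
    have : latticeNorm v ^ (3 : ℝ) = latticeNorm v ^ 3 := by exact_mod_cast rpow_natCast _ 3
    rw [this]
    ring
  rw [e]
  rcases le_total (η * latticeNorm v) 1 with h | h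
  · refine (abs_wave_sub_le hv hy h0 h1).trans ?_
    refine mul_le_mul_of_nonneg_left (le_mul_of_one_le_right (by positivity) ?_) (by positivity)
    exact one_le_rpow_of_pos_of_le_one_of_nonpos (by positivity) h (neg_nonpos.2 hθ.le)
  · refine (abs_wave_sub_le' hy h0 h1).trans ?_
    gcongr
    have h2 : (η * latticeNorm v) ^ (-1 : ℝ) ≤ (η * latticeNorm v) ^ (-θ) :=
      rpow_le_rpow_of_exponent_le h (by linarith)
    rw [rpow_neg_one] at h2
    calc (latticeNorm v ^ 4)⁻¹ = η * (latticeNorm v ^ 3)⁻¹ * (η * latticeNorm v)⁻¹ := by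
          field_simp
      _ ≤ _ := by gcongr

theorem exists_abs_tsum_wave_sub_le :
    ∃ C : ℝ, 0 < C ∧ ∀ x y : ℝ, 3 ≤ x → 1 ≤ y → y ≤ x →
      |((y + (x ^ 2)⁻¹) * cosSum (y + (x ^ 2)⁻¹) - 3 * sinSum (y + (x ^ 2)⁻¹)) -
        (y * cosSum y - 3 * sinSum y)| ≤ C * (x ^ 2)⁻¹ * (x * log x) := by
  obtain ⟨C, hC, h⟩ := exists_tsum_latticeNorm_rpow_le
  refine ⟨18 * exp 2 * C, by positivity, fun x y hx hy hyx => ?_⟩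
  have hx0 : 0 < x := by linarith
  have hlog : 1 ≤ log x := by
    rw [le_log_iff_exp_le hx0]; linarith [exp_one_lt_d9]
  set η := (x ^ 2)⁻¹ with hη
  have h0 : 0 < η := by positivity
  have h1 : η ≤ 1 := inv_le_one_of_one_le₀ (by nlinarith)
  set θ := (log x)⁻¹ with hθ
  have hθ0 : 0 < θ := by positivity
  have hθ1 : θ ≤ 1 := inv_le_one_of_one_le₀ hlog
  obtain ⟨hs, hle⟩ := h θ hθ0 hθ1
  -- the exponent `θ = 1 / log x` makes `η ^ (-θ)` a constant
  have hηθ : η ^ (1 - θ) = exp 2 * η := by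
    rw [sub_eq_neg_add, rpow_add h0, rpow_one, rpow_def_of_pos h0]
    congr 2
    rw [hη, log_inv, log_pow, hθ]
    field_simp
    norm_num
  have hterm : ∀ v, ‖wave v (y + η) - wave v y‖ ≤
      18 * y * η ^ (1 - θ) * latticeNorm v ^ (-(3 + θ)) := by
    intro v
    rcases eq_or_ne v 0 with rfl | hv
    · have : ∀ x, wave 0 x = 0 := fun x => by simp [wave, freq_zero]
      rw [this, this, sub_zero, norm_zero]
      have := rpow_nonneg (latticeNorm_nonneg 0) (-(3 + θ))
      positivity
    · rw [mul_assoc]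
      exact abs_wave_sub_le_rpow hv hy h0 h1 hθ0 hθ1
  have h2 := tsum_of_norm_bounded (hs.mul_left (18 * y * η ^ (1 - θ))).hasSum hterm
  rw [((hasSum_wave (y + η)).sub (hasSum_wave y)).tsum_eq, tsum_mul_left] at h2
  refine h2.trans ?_
  have h3 : C / θ = C * log x := by rw [hθ, div_inv_eq_mul]
  rw [h3] at hle
  rw [hηθ]
  have h4 : 0 ≤ ∑' v, latticeNorm v ^ (-(3 + θ)) :=
    tsum_nonneg fun v => rpow_nonneg (latticeNorm_nonneg v) (-(3 + θ))
  calc _ ≤ 18 * x * (exp 2 * η) * (C * log x) := by gcongr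
    _ = _ := by ring

theorem isBigO_iterCount_one_sub :
    (fun R : ℝ => iterCount 1 R - π / 3 * R ^ 4) =O[atTop] (fun R : ℝ => R * log R) := by
  obtain ⟨C, hC, h⟩ := exists_abs_tsum_wave_sub_le
  refine Asymptotics.IsBigO.of_bound (2 * π + 4 * π * C) ?_
  filter_upwards [eventually_ge_atTop 3] with x hx
  have hx0 : 0 < x := by linarith
  have hlog : 1 ≤ log x := by
    rw [le_log_iff_exp_le hx0]; linarith [exp_one_lt_d9]
  have hxl : 0 ≤ x * log x := by positivity
  have hxl' : x ≤ x * log x := le_mul_of_one_le_right hx0.le hlog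
  have hup := abs_le.1 (h x x hx (by linarith) le_rfl)
  set η := (x ^ 2)⁻¹ with hη
  have h0 : 0 < η := by positivity
  have h1 : η ≤ 1 := inv_le_one_of_one_le₀ (by nlinarith)
  have hlow := abs_le.1 (h x (x - η) hx (by linarith) (by linarith))
  rw [← hη, sub_add_cancel] at hlow
  have hint : ∀ a b, IntervalIntegrable (iterCount 1) volume a b :=
    fun a b => continuous_iterCount_one.intervalIntegrable a b
  have hηx : η * x ^ 2 = 1 := inv_mul_cancel₀ (by positivity)
  -- `iterCount 1` is monotone, so it lies between its means over the adjacent intervals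
  have hA : η * iterCount 1 x ≤ iterCount 2 (x + η) - iterCount 2 x := by
    rw [iterCount_two_sub]
    have := intervalIntegral.integral_mono_on (a := x) (b := x + η) (by linarith)
      (intervalIntegrable_const (c := iterCount 1 x)) (hint _ _)
      fun t ht => iterCount_one_mono hx0.le ht.1
    simpa using this
  have hB : iterCount 2 x - iterCount 2 (x - η) ≤ η * iterCount 1 x := by
    rw [iterCount_two_sub]
    have := intervalIntegral.integral_mono_on (a := x - η) (b := x) (by linarith)
      (hint _ _) (intervalIntegrable_const (c := iterCount 1 x))
      fun t ht => iterCount_one_mono (by linarith [ht.1]) ht.2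
    simpa using this
  rw [iterCount_two_eq_expansion hx0, iterCount_two_eq_expansion (by linarith)] at hA hB
  have hπ := pi_pos
  have hp1 : (x + η) ^ 5 - x ^ 5 ≤ 5 * x ^ 4 * η + η * (26 * x) := by
    have e : (x + η) ^ 5 - x ^ 5 = 5 * x ^ 4 * η +
        η * (10 * x * (η * x ^ 2) + 10 * η * (η * x ^ 2) + 5 * x * η ^ 3 + η ^ 4) := by ring
    rw [e, hηx]
    have := pow_le_one₀ h0.le h1 (n := 3)
    have := pow_le_one₀ h0.le h1 (n := 4)
    gcongr
    nlinarith
  have hp2 : 5 * x ^ 4 * η - η * (26 * x) ≤ x ^ 5 - (x - η) ^ 5 := by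
    have e : x ^ 5 - (x - η) ^ 5 = 5 * x ^ 4 * η - η * (10 * x * (η * x ^ 2) -
        10 * η * (η * x ^ 2) + 5 * x * η ^ 3 - η ^ 4) := by ring
    rw [e, hηx]
    have := pow_le_one₀ h0.le h1 (n := 3)
    have : 0 ≤ η ^ 4 := by positivity
    gcongr
    nlinarith
  have m0 : π / 15 * (η * (26 * x)) ≤ 2 * π * (η * (x * log x)) := by
    have : 0 ≤ π * (η * (x * log x) - η * x) :=
      mul_nonneg hπ.le (sub_nonneg.2 (mul_le_mul_of_nonneg_left hxl' h0.le))
    have : 0 ≤ π * (η * x) := by positivity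
    linarith
  have m1 := mul_le_mul_of_nonneg_left hp1 (by positivity : 0 ≤ π / 15)
  have m2 := mul_le_mul_of_nonneg_left hp2 (by positivity : 0 ≤ π / 15)
  have m3 := mul_le_mul_of_nonneg_left hup.2 (by positivity : 0 ≤ 4 * π)
  have m4 := mul_le_mul_of_nonneg_left hlow.1 (by positivity : 0 ≤ 4 * π)
  rw [norm_of_nonneg hxl, norm_eq_abs, abs_le]
  constructor
  · refine le_of_mul_le_mul_left ?_ h0
    linarith
  · refine le_of_mul_le_mul_left ?_ h0
    linarith

/-! ### Absence of a second term -/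

/-- An almost periodic sum returns to its value at `0`: the sum is a continuous function on the
compact group of families of points of the circle, evaluated at the powers of `(exp (i k_v))_v`, and
these powers cluster at `1`. -/
theorem mapClusterPt_cos_sum (c : (Fin 3 → ℤ) → ℝ) (hc : Summable c) :
    MapClusterPt (∑' v, c v) atTop fun n : ℕ => ∑' v, cos (freq v * n) * c v := by
  set Ψ : ((Fin 3 → ℤ) → Circle) → ℝ := fun z => ∑' v, (z v : ℂ).re * c v with hΨ
  have hcont : Continuous Ψ := by
    refine continuous_tsum (u := fun v => ‖c v‖) (fun v => ?_) hc.norm fun v z => ?_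
    · fun_prop
    · rw [norm_mul]
      refine mul_le_of_le_one_left (norm_nonneg _) ?_
      exact (Complex.abs_re_le_norm _).trans (Circle.norm_coe _).le
  have h1 := (mapClusterPt_one_atTop_pow fun v : Fin 3 → ℤ => Circle.exp (freq v)).continuousAt_comp
    hcont.continuousAt
  have e1 : Ψ 1 = ∑' v, c v := by simp [hΨ]
  rw [e1] at h1
  convert h1 using 2 with n
  simp only [hΨ, Function.comp_apply, Pi.pow_apply, ← Circle.exp_nsmul]
  refine tsum_congr fun v => ?_
  rw [Circle.coe_exp, Complex.exp_ofReal_mul_I_re]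
  simp [mul_comm]

theorem not_isLittleO_iterCount_one_sub (α : ℝ) :
    ¬ (fun R : ℝ => iterCount 1 R - (π / 3 * R ^ 4 + α * R)) =o[atTop] (fun R : ℝ => R) := by
  intro h
  set e : ℝ → ℝ := fun R => iterCount 1 R - (π / 3 * R ^ 4 + α * R) with he
  set M := ∑' v, (freq v ^ 4)⁻¹
  -- the integral of the remainder over `[x, x + 1/2]`
  set G : ℝ → ℝ := fun x => ∫ t in x..(x + 1 / 2), e t with hG
  have hGo : Tendsto (fun x => G x / x) atTop (𝓝 0) := by
    refine Asymptotics.IsLittleO.tendsto_div_nhds_zero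
      (Asymptotics.IsLittleO.of_bound fun δ hδ => ?_)
    obtain ⟨X, hX⟩ := eventually_atTop.1 (h.bound hδ)
    filter_upwards [eventually_ge_atTop X, eventually_ge_atTop 1] with x hx hx1
    have := intervalIntegral.norm_integral_le_of_norm_le_const (a := x) (b := x + 1 / 2)
      (C := δ * (2 * x)) (f := e) fun t ht => by
        rw [uIoc_of_le (by linarith)] at ht
        refine (hX t (by linarith [ht.1])).trans ?_
        rw [norm_of_nonneg (by linarith [ht.1])]
        gcongr
        linarith [ht.2]
    refine this.trans (le_of_eq ?_)
    rw [norm_of_nonneg (by linarith : (0 : ℝ) ≤ x), add_sub_cancel_left, abs_of_pos (by norm_num)]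
    ring
  have hGeq : ∀ x : ℝ, 0 < x → G x = 4 * π * (((x + 1 / 2) * cosSum (x + 1 / 2) -
      3 * sinSum (x + 1 / 2)) - (x * cosSum x - 3 * sinSum x)) - α * (x / 2 + 1 / 8) := by
    intro x hx
    have h1 := iterCount_two_sub x (x + 1 / 2)
    rw [iterCount_two_eq_expansion hx, iterCount_two_eq_expansion (by linarith)] at h1
    have hp : Continuous fun t : ℝ => π / 3 * t ^ 4 + α * t := by fun_prop
    have h2 : G x = (∫ t in x..(x + 1 / 2), iterCount 1 t) -
        ∫ t in x..(x + 1 / 2), (π / 3 * t ^ 4 + α * t) :=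
      intervalIntegral.integral_sub (continuous_iterCount_one.intervalIntegrable _ _)
        (hp.intervalIntegrable _ _)
    have h3 : ∫ t in x..(x + 1 / 2), (π / 3 * t ^ 4 + α * t) =
        π / 15 * ((x + 1 / 2) ^ 5 - x ^ 5) + α * (x / 2 + 1 / 8) := by
      rw [intervalIntegral.integral_add ((by fun_prop : Continuous fun t : ℝ => π / 3 * t ^ 4
        ).intervalIntegrable _ _) ((by fun_prop : Continuous fun t : ℝ => α * t
        ).intervalIntegrable _ _), intervalIntegral.integral_const_mul,
        intervalIntegral.integral_const_mul, integral_pow, integral_id]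
      push_cast
      ring
    rw [h2, h3, ← h1]
    ring
  set F : ℝ → ℝ := fun x => cosSum (x + 1 / 2) - cosSum x with hF
  have hFlim : Tendsto F atTop (𝓝 (α / (8 * π))) := by
    have hb : Tendsto (fun x : ℝ => (1 / 2 * cosSum (x + 1 / 2) -
        3 * sinSum (x + 1 / 2) + 3 * sinSum x) / x) atTop (𝓝 0) := by
      have hbd : IsBoundedUnder (· ≤ ·) atTop (norm ∘ fun x : ℝ =>
          1 / 2 * cosSum (x + 1 / 2) - 3 * sinSum (x + 1 / 2) + 3 * sinSum x) := by
        refine isBoundedUnder_of ⟨8 * M, fun x => ?_⟩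
        have h1 := abs_le.1 (abs_cosSum_le (x + 1 / 2))
        have h2 := abs_le.1 (abs_sinSum_le (x + 1 / 2))
        have h3 := abs_le.1 (abs_sinSum_le x)
        rw [Function.comp_apply, norm_eq_abs, abs_le]
        constructor <;> linarith [h1.1, h1.2, h2.1, h2.2, h3.1, h3.2]
      simpa [div_eq_inv_mul] using tendsto_inv_atTop_zero.zero_mul_isBoundedUnder_le hbd
    have h8 : Tendsto (fun x : ℝ => α * (1 / 2 + 1 / 8 / x)) atTop (𝓝 (α * (1 / 2 + 0))) :=
      ((tendsto_const_nhds.div_atTop tendsto_id).const_add _).const_mul _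
    have := ((hGo.add h8).div_const (4 * π)).sub hb
    have e : α / (8 * π) = (0 + α * (1 / 2 + 0)) / (4 * π) - 0 := by field_simp; ring
    rw [e]
    refine this.congr' ?_
    filter_upwards [eventually_gt_atTop 0] with x hx
    rw [hGeq x hx]
    simp only [hF]
    field_simp
    ring
  have hS : Tendsto (fun n : ℕ => F n - F (n - 1 / 2)) atTop (𝓝 0) := by
    have h1 : Tendsto (fun n : ℕ => (n : ℝ)) atTop atTop := tendsto_natCast_atTop_atTop
    have h2 : Tendsto (fun n : ℕ => (n : ℝ) - 1 / 2) atTop atTop :=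
      tendsto_atTop_add_const_right _ _ h1
    simpa using (hFlim.comp h1).sub (hFlim.comp h2)
  set c : (Fin 3 → ℤ) → ℝ := fun v => 2 * (cos (freq v * (1 / 2)) - 1) / freq v ^ 4 with hc
  have hcle : ∀ v, c v ≤ 0 := fun v => by
    have := freq_nonneg v
    exact div_nonpos_of_nonpos_of_nonneg (by linarith [cos_le_one (freq v * (1 / 2))])
      (by positivity)
  have hcs : Summable c := by
    have := ((summable_cosTerm (1 / 2)).sub (summable_cosTerm 0)).mul_left 2
    refine this.congr fun v => ?_
    simp only [hc, mul_zero, cos_zero]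
    ring
  have hSeq : ∀ n : ℕ, F n - F (n - 1 / 2) = ∑' v, cos (freq v * n) * c v := by
    intro n
    have h1 := ((summable_cosTerm (n + 1 / 2)).hasSum.sub (summable_cosTerm n).hasSum).sub
      ((summable_cosTerm n).hasSum.sub (summable_cosTerm (n - 1 / 2)).hasSum)
    have h2 : F n - F (n - 1 / 2) = cosSum (n + 1 / 2) - cosSum n -
        (cosSum n - cosSum (n - 1 / 2)) := by
      simp [hF]
    rw [h2]
    refine h1.tsum_eq.symm.trans (tsum_congr fun v => ?_)
    simp only [hc]
    rw [mul_add, mul_sub, cos_add, cos_sub]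
    ring
  have hcl := mapClusterPt_cos_sum c hcs
  simp only [← hSeq] at hcl
  have hzero : ∑' v, c v = 0 := by
    have : (𝓝 (∑' v, c v) ⊓ 𝓝 0).NeBot := ClusterPt.mono hcl hS
    exact eq_of_nhds_neBot this
  have hneg : c (Pi.single 0 1) < 0 := by
    have : freq (Pi.single 0 1) = 2 * π := by rw [freq, latticeNorm_single, mul_one]
    simp only [hc, this]
    rw [show 2 * π * (1 / 2) = π by ring, cos_pi]
    have := pi_pos
    exact div_neg_of_neg_of_pos (by norm_num) (by positivity)
  have := hcs.neg.tsum_pos (fun v => neg_nonneg.2 (hcle v)) (Pi.single 0 1) (neg_pos.2 hneg)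
  rw [tsum_neg, hzero] at this
  simp at this

theorem corollary2 :
    ((fun R : ℝ => iterCount 1 R - Real.pi / 3 * R ^ 4)
        =O[Filter.atTop] (fun R : ℝ => R * Real.log R)) ∧
    ¬ ∃ ε : ℝ, 0 < ε ∧ ∃ α : ℝ,
      ((fun R : ℝ => iterCount 1 R - (Real.pi / 3 * R ^ 4 + α * R))
        =O[Filter.atTop] (fun R : ℝ => R ^ (1 - ε))) := by
  refine ⟨isBigO_iterCount_one_sub, ?_⟩
  rintro ⟨ε, hε, α, h⟩
  refine not_isLittleO_iterCount_one_sub α (h.trans_isLittleO ?_)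
  refine Asymptotics.isLittleO_of_tendsto' ?_ ((tendsto_rpow_neg_atTop hε).congr' ?_)
  · filter_upwards [eventually_gt_atTop 0] with x hx hx0 using absurd hx0 hx.ne'
  · filter_upwards [eventually_gt_atTop 0] with x hx
    rw [show 1 - ε = -ε + 1 by ring, rpow_add_one hx.ne', mul_div_cancel_right₀ _ hx.ne']
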